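/- Let $\Gamma\subset\mathbb{R}^3$ be a closed (compact, without boundary), connected, oriented embedded surface of class $C^3$ with unit normal field $n$. Put $P=I_3-n\otimes n$; for $\eta\in C^1(\Gamma)$ let $\underline{D}_i\eta=\sum_jP_{ij}\partial_j\tilde\eta$ for any $C^1$ extension $\tilde\eta$ of $\eta$, and $\nabla_\Gamma\eta=(\underline{D}_i\eta)_i$. For a vector field $v$ and a matrix field $A$ of class $C^1$ let $\nabla_\Gamma v=(\underline{D}_iv_j)_{i,j}$, $\mathrm{div}_\Gamma v=\mathrm{tr}[\nabla_\Gamma v]$, $D_\Gamma(v)=P\,\frac{\nabla_\Gamma v+(\nabla_\Gamma v)^T}{2}\,P$ and $[\mathrm{div}_\Gamma A]_j=\sum_i\underline{D}_iA_{ij}$. Write $C^m(\Gamma,T\Gamma)$ for the tangential $C^m$ vector fields on $\Gamma$. Let $\overline\nabla_YX=P(\nabla_\Gamma X)^TY$ be the covariant derivative and $(\overline\nabla X)(Y,Z)=\overline\nabla_ZX\cdot Y$. Let $\overline\nabla^\ast$ be the formal adjoint of $\overline\nabla$: $\overline\nabla^\ast S\in C(\Gamma,T\Gamma)$ and $\int_\Gamma\overline\nabla^\ast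 S\cdot Y\,d\mathcal{H}^2=\int_\Gamma\langle S,\overline\nabla Y\rangle\,d\mathcal{H}^2$ for all $Y\in C^1(\Gamma,T\Gamma)$, where $\langle S,T\rangle=\sum_{i,j}S(\tau_i,\tau_j)T(\tau_i,\tau_j)$ for an orthonormal basis $\{\tau_1,\tau_2\}$ of the tangent plane. Let $\Delta_BX=-\overline\nabla^\ast\overline\nabla X$ be the Bochner Laplacian, $R(X,Y)Z=\overline\nabla_X\overline\nabla_YZ-\overline\nabla_Y\overline\nabla_XZ-\overline\nabla_{\overline\nabla_XY-\overline\nabla_YX}Z$, and $\mathrm{Ric}(X)=\sum_{i=1,2}R(X,\tau_i)\tau_i$ for any $C^2$ local orthonormal frame $\{\tau_1,\tau_2\}$ of $T\Gamma$. (i) For every $X\in C^2(\Gamma,T\Gamma)$ the field $\Delta_BX$ exists and is unique; $C^2$ local orthonormal frames exist around every point of $\Gamma$, $\mathrm{Ric}(X)$ does not depend on the choice of the frame, and $$2P\,\mathrm{div}_\Gamma[D_\Gamma(X)]=\Delta_BX+\nabla_\Gamma(\mathrm{div}_\Gamma X)+\mathrm{Ric}(X)\quad\text{on }\Gamma.$$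 (ii) Consequently, let $\nu>0$, let $f$ be a force, $v_0$ an initial velocity, and let $v$, $q$ be such that $v(t)\in C^2(\Gamma,T\Gamma)$ and $q(t)\in C^1(\Gamma)$ for all $t>0$ and $t\mapsto v(y,t)$ is differentiable on $(0,\infty)$ for each $y\in\Gamma$. Then $(v,q)$ satisfies the limit equations $$g(\partial_tv+\overline\nabla_vv)-2\nu\Bigl\{P\,\mathrm{div}_\Gamma[gD_\Gamma(v)]-\frac1g(v\cdot\nabla_\Gamma g)\nabla_\Gamma g\Bigr\}+(\gamma^0+\gamma^1)v+g\nabla_\Gamma q=gf,\quad \mathrm{div}_\Gamma(gv)=0\quad\text{on }\Gamma\times(0,\infty),\quad v|_{t=0}=v_0$$ with $g\equiv1$ and $\gamma^0=\gamma^1=0$ if and only if it satisfies the Riemannian Navier–Stokes equations $$\partial_tv+\overline\nabla_vv-\nu\{\Delta_Bv+\mathrm{Ric}(v)\}+\nabla_\Gamma q=f,\quad \mathrm{div}_\Gamma v=0\quad\text{on }\Gamma\times(0,\infty),\quad v|_{t=0}=v_0.$$ -/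

import Mathlib

open MeasureTheory Filter Topology

noncomputable section

/-- Three-dimensional Euclidean space. -/
abbrev R3 : Type := EuclideanSpace ℝ (Fin 3)

/-- The plane of parameters. -/
abbrev R2 : Type := EuclideanSpace ℝ (Fin 2)

/-- Matrix times column vector in `ℝ³`. -/
def matVec (A : Matrix (Fin 3) (Fin 3) ℝ) (a : R3) : R3 :=
  WithLp.toLp 2 (A.mulVec (fun j => a j))

/-- `μ : U → Γ` is a local parametrization of class `C^l` of the set `Γ ⊆ ℝ³`: `U` is open in
`ℝ²`, `μ` is a `C^l` immersion and a homeomorphism of `U` onto a relatively open subset of `Γ`. -/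
structure IsLocalParam (l : ℕ) (Γ : Set R3) (U : Set R2) (μ : R2 → R3) : Prop where
  isOpen_source : IsOpen U
  contDiffOn : ContDiffOn ℝ l μ U
  injective_fderiv : ∀ s ∈ U, Function.Injective (fderiv ℝ μ s)
  exists_isOpen_image : ∃ V : Set R3, IsOpen V ∧ μ '' U = Γ ∩ V
  exists_continuous_inverse : ∃ σ : R3 → R2, ContinuousOn σ (μ '' U) ∧ ∀ s ∈ U, σ (μ s) = s

/-- A closed (compact, without boundary), connected, oriented surface of class `C^l` in `ℝ³`,
the orientation being given by a continuous unit normal vector field. -/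
structure ClosedSurface (l : ℕ) where
  /-- the set of points of the surface -/
  carrier : Set R3
  /-- the unit normal field; only its values on the surface are relevant -/
  normal : R3 → R3
  isCompact : IsCompact carrier
  isConnected : IsConnected carrier
  exists_param : ∀ y ∈ carrier, ∃ U μ, IsLocalParam l carrier U μ ∧ y ∈ μ '' U
  continuousOn_normal : ContinuousOn normal carrier
  norm_normal : ∀ y ∈ carrier, ‖normal y‖ = 1
  normal_orthogonal : ∀ U μ, IsLocalParam l carrier U μ →
    ∀ s ∈ U, ∀ w : R2, inner ℝ (normal (μ s)) (fderiv ℝ μ s w) = 0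

/-- `η` is of class `C^m` on the subset `A` of `ℝ³`: near each point of `A` it is the restriction
of a `C^m` function of the ambient space. (On a relatively open subset of a `C^l` surface with
`m ≤ l` this is the same as being `C^m` in local parametrizations.)
Only the values of `η` on `A` are relevant. -/
def IsCmOn {F : Type*} [NormedAddCommGroup F] [NormedSpace ℝ F]
    (m : ℕ) (η : R3 → F) (A : Set R3) : Prop :=
  ∀ y ∈ A, ∃ η' : R3 → F, ContDiffAt ℝ m η' y ∧ η' =ᶠ[𝓝[A] y] η

namespace ClosedSurface

variable {l : ℕ} (S : ClosedSurface l)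

/-- The orthogonal projection `P = I₃ - n ⊗ n` onto the tangent plane. -/
def P (y : R3) : Matrix (Fin 3) (Fin 3) ℝ :=
  Matrix.of fun i j => (if i = j then 1 else 0) - S.normal y i * S.normal y j

/-- The tangent plane `T_yΓ`, as a subspace of `ℝ³`. -/
def tangentPlane (y : R3) : Submodule ℝ R3 := (Submodule.span ℝ {S.normal y})ᗮ

/-- `X ∈ C^m(A, TΓ)`: a tangential vector field of class `C^m` on the subset `A` of `Γ`. -/
def IsTangentialOn (m : ℕ) (X : R3 → R3) (A : Set R3) : Prop :=
  IsCmOn m X A ∧ ∀ y ∈ A, inner ℝ (X y) (S.normal y) = 0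

/-- `X ∈ C^m(Γ, TΓ)`. -/
def IsTangential (m : ℕ) (X : R3 → R3) : Prop := S.IsTangentialOn m X S.carrier

/-- The tangential derivative `D_i η = ∑ j, P_ij ∂_j η'` at points of `Γ`, where `η'` is an
extension of `η`. The derivative of `η` within `Γ` stands for the derivative of an extension;
the lemma `tanDeriv_eq` below shows that every extension gives the same value. -/
def tanDeriv (i : Fin 3) (η : R3 → ℝ) (y : R3) : ℝ :=
  ∑ j, S.P y i j * fderivWithin ℝ η S.carrier y (EuclideanSpace.single j 1)

/-- Every tangent vector of the surface lies in the tangent cone of the underlying set. -/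
theorem mem_tangentConeAt (hl : 1 ≤ l) {y : R3} (hy : y ∈ S.carrier) {w : R3}
    (hw : inner ℝ (S.normal y) w = 0) : w ∈ tangentConeAt ℝ S.carrier y := by
  obtain ⟨U, μ, hμ, s, hs, rfl⟩ := S.exists_param y hy
  have hsub : μ '' U ⊆ S.carrier := by
    obtain ⟨V, -, hV⟩ := hμ.exists_isOpen_image
    rw [hV]
    exact Set.inter_subset_left
  have hU : U ∈ 𝓝 s := hμ.isOpen_source.mem_nhds hs
  have hl' : (l : WithTop ℕ∞) ≠ 0 := by
    have : l ≠ 0 := by omega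
    exact_mod_cast this
  have hd : HasFDerivAt μ (fderiv ℝ μ s) s :=
    ((hμ.contDiffOn.contDiffAt hU).differentiableAt hl').hasFDerivAt
  have hn : S.normal (μ s) ≠ 0 := by
    intro h
    have := S.norm_normal _ hy
    rw [h] at this
    simp at this
  have hrange : LinearMap.range (fderiv ℝ μ s).toLinearMap =
      (Submodule.span ℝ {S.normal (μ s)})ᗮ := by
    apply Submodule.eq_of_le_of_finrank_eq
    · rintro _ ⟨u, rfl⟩
      rw [Submodule.mem_orthogonal_singleton_iff_inner_right]
      exact S.normal_orthogonal U μ hμ s hs u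
    · rw [LinearMap.finrank_range_of_inj (hμ.injective_fderiv s hs)]
      have h1 := Submodule.finrank_add_finrank_orthogonal (Submodule.span ℝ {S.normal (μ s)})
      rw [finrank_span_singleton hn] at h1
      simp only [finrank_euclideanSpace, Fintype.card_fin] at h1 ⊢
      omega
  have hmem : w ∈ LinearMap.range (fderiv ℝ μ s).toLinearMap := by
    rw [hrange, Submodule.mem_orthogonal_singleton_iff_inner_right]
    exact hw
  obtain ⟨u, rfl⟩ := hmem
  have hu : u ∈ tangentConeAt ℝ U s := by
    rw [tangentConeAt_of_mem_nhds hU]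
    exact Set.mem_univ u
  exact tangentConeAt_mono hsub (hd.hasFDerivWithinAt.mapsTo_tangent_cone hu)

/-- The tangential derivatives can be computed with an arbitrary extension. -/
theorem tanDeriv_eq (hl : 1 ≤ l) (i : Fin 3) (η η' : R3 → ℝ) {y : R3} (hy : y ∈ S.carrier)
    (hη' : DifferentiableAt ℝ η' y) (h : η' =ᶠ[𝓝[S.carrier] y] η) :
    S.tanDeriv i η y = ∑ j, S.P y i j * fderiv ℝ η' y (EuclideanSpace.single j 1) := by
  have h1 : HasFDerivWithinAt η (fderiv ℝ η' y) S.carrier y :=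
    hη'.hasFDerivAt.hasFDerivWithinAt.congr_of_eventuallyEq h.symm
      (h.symm.eq_of_nhdsWithin hy)
  have h2 := h1.differentiableWithinAt.hasFDerivWithinAt
  have hnorm : ∑ j, S.normal y j * S.normal y j = 1 := by
    have := EuclideanSpace.real_norm_sq_eq (S.normal y)
    rw [S.norm_normal y hy] at this
    simpa [pow_two] using this.symm
  have key : ∀ L : R3 →L[ℝ] ℝ, ∑ j, S.P y i j * L (EuclideanSpace.single j 1) =
      L (∑ j, S.P y i j • EuclideanSpace.single j 1) := by
    intro L
    simp [map_sum]
  unfold tanDeriv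
  rw [key, key]
  refine HasFDerivWithinAt.unique_on h2 h1 (S.mem_tangentConeAt hl hy ?_)
  rw [inner_sum]
  simp only [inner_smul_right, EuclideanSpace.inner_single_right]
  simp only [P, Matrix.of_apply, Fin.sum_univ_three] at hnorm ⊢
  fin_cases i <;> simp <;> linear_combination (-(S.normal y _)) * hnorm

/-- The tangential gradient `∇_Γ η = (D_1 η, D_2 η, D_3 η)`. -/
def grad (η : R3 → ℝ) (y : R3) : R3 := WithLp.toLp 2 (fun i => S.tanDeriv i η y)

/-- The tangential gradient matrix `(∇_Γ v)_ij = D_i v_j`. -/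
def gradMat (v : R3 → R3) (y : R3) : Matrix (Fin 3) (Fin 3) ℝ :=
  Matrix.of fun i j => S.tanDeriv i (fun z => v z j) y

/-- The surface divergence `div_Γ v = tr (∇_Γ v)` of a vector field. -/
def div (v : R3 → R3) (y : R3) : ℝ := (S.gradMat v y).trace

/-- The surface divergence of a matrix field, `[div_Γ A]_j = ∑ i, D_i A_ij`. -/
def divMat (A : R3 → Matrix (Fin 3) (Fin 3) ℝ) (y : R3) : R3 :=
  WithLp.toLp 2 (fun j => ∑ i, S.tanDeriv i (fun z => A z i j) y)

/-- The surface strain rate tensor `D_Γ(v) = P (∇_Γ v + (∇_Γ v)ᵀ)/2 P`. -/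
def strain (v : R3 → R3) (y : R3) : Matrix (Fin 3) (Fin 3) ℝ :=
  S.P y * ((1 / 2 : ℝ) • (S.gradMat v y + (S.gradMat v y).transpose)) * S.P y

/-- The covariant derivative of `X` at `y` along the tangent vector `a`,
`P (a · ∇_Γ) X = P (∇_Γ X)ᵀ a`. -/
def covDerivAt (X : R3 → R3) (y a : R3) : R3 :=
  matVec (S.P y) (matVec (S.gradMat X y).transpose a)

/-- The covariant derivative of the vector field `X` along the vector field `Y`. -/
def covDeriv (Y X : R3 → R3) (y : R3) : R3 := S.covDerivAt X y (Y y)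

/-- The curvature tensor `R(X,Y)Z = ∇_X ∇_Y Z - ∇_Y ∇_X Z - ∇_{∇_X Y - ∇_Y X} Z`. -/
def curv (X Y Z : R3 → R3) (y : R3) : R3 :=
  S.covDeriv X (S.covDeriv Y Z) y - S.covDeriv Y (S.covDeriv X Z) y
    - S.covDeriv (fun z => S.covDeriv X Y z - S.covDeriv Y X z) Z y

/-- `(τ 0, τ 1)` is a (`C²`) local orthonormal frame for `TΓ` on the relatively open subset
`Γ ∩ V` of `Γ`. -/
structure IsFrame (V : Set R3) (τ : Fin 2 → R3 → R3) : Prop where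
  isOpen : IsOpen V
  tangential : ∀ i, S.IsTangentialOn 2 (τ i) (S.carrier ∩ V)
  orthonormal : ∀ y ∈ S.carrier ∩ V, Orthonormal ℝ (fun i => τ i y)

open scoped Classical in
/-- The Ricci curvature acting on vector fields: `Ric(X) = ∑ i, R(X, τ_i) τ_i` at `y`, where
`τ` is a local orthonormal frame around `y`. -/
def ricci (X : R3 → R3) (y : R3) : R3 :=
  if h : ∃ Vτ : Set R3 × (Fin 2 → R3 → R3), S.IsFrame Vτ.1 Vτ.2 ∧ y ∈ Vτ.1 then
    ∑ i, S.curv X (h.choose.2 i) (h.choose.2 i) y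
  else 0

/-- The inner product `∑ i j, T(τ_i, τ_j) T'(τ_i, τ_j)` of two bilinear forms on `T_yΓ`, where
`τ` is an orthonormal basis of `T_yΓ`. -/
def formInner (y : R3) (T T' : R3 → R3 → ℝ) : ℝ :=
  ∑ i, ∑ j,
    T (stdOrthonormalBasis ℝ (S.tangentPlane y) i) (stdOrthonormalBasis ℝ (S.tangentPlane y) j) *
    T' (stdOrthonormalBasis ℝ (S.tangentPlane y) i) (stdOrthonormalBasis ℝ (S.tangentPlane y) j)

/-- The `(0,2)`-tensor field `(∇X)(a, b) = (∇_b X) · a`. -/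
def covTensor (X : R3 → R3) (y a b : R3) : ℝ := inner ℝ (S.covDerivAt X y b) a

/-- `Z ∈ C(Γ, TΓ)` is the value at the `(0,2)`-tensor field `T` of the formal adjoint of the
Riemannian connection: `∫_Γ Z · Y dH² = ∫_Γ ⟨T, ∇Y⟩ dH²` for all `Y ∈ C¹(Γ, TΓ)`. -/
def IsCovAdjoint (T : R3 → R3 → R3 → ℝ) (Z : R3 → R3) : Prop :=
  S.IsTangential 0 Z ∧ ∀ Y, S.IsTangential 1 Y →
    ∫ y in S.carrier, inner ℝ (Z y) (Y y) ∂μHE[2] =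
      ∫ y in S.carrier, S.formInner y (T y) (S.covTensor Y y) ∂μHE[2]

open scoped Classical in
/-- The formal adjoint of the Riemannian connection. -/
def covAdjoint (T : R3 → R3 → R3 → ℝ) : R3 → R3 :=
  if h : ∃ Z, S.IsCovAdjoint T Z then h.choose else 0

/-- The Bochner Laplacian `Δ_B X = -∇*∇X`. -/
def bochner (X : R3 → R3) (y : R3) : R3 := -S.covAdjoint (S.covTensor X) y

/-- The limit equations on `Γ × (0,∞)` with viscosity `ν`, weight `g`, friction coefficients
`γ₀, γ₁`, force `f` and initial velocity `v₀`, for the velocity `v` and the pressure `q`. -/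
def SolvesLimitEquations (ν γ₀ γ₁ : ℝ) (g : R3 → ℝ) (f : ℝ → R3 → R3) (v₀ : R3 → R3)
    (v : ℝ → R3 → R3) (q : ℝ → R3 → ℝ) : Prop :=
  (∀ t > 0, ∀ y ∈ S.carrier,
    g y • (deriv (fun s => v s y) t + S.covDeriv (v t) (v t) y)
      - (2 * ν) • (matVec (S.P y) (S.divMat (fun z => g z • S.strain (v t) z) y)
        - (1 / g y) • (inner ℝ (v t y) (S.grad g y) • S.grad g y))
      + (γ₀ + γ₁) • v t y + g y • S.grad (q t) y = g y • f t y) ∧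
  (∀ t > 0, ∀ y ∈ S.carrier, S.div (fun z => g z • v t z) y = 0) ∧
  ∀ y ∈ S.carrier, v 0 y = v₀ y

/-- The Navier–Stokes equations on the Riemannian manifold `Γ` whose viscous term contains the
Ricci curvature. -/
def SolvesRiemannianNavierStokes (ν : ℝ) (f : ℝ → R3 → R3) (v₀ : R3 → R3)
    (v : ℝ → R3 → R3) (q : ℝ → R3 → ℝ) : Prop :=
  (∀ t > 0, ∀ y ∈ S.carrier,
    deriv (fun s => v s y) t + S.covDeriv (v t) (v t) y
      - ν • (S.bochner (v t) y + S.ricci (v t) y) + S.grad (q t) y = f t y) ∧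
  (∀ t > 0, ∀ y ∈ S.carrier, S.div (v t) y = 0) ∧
  ∀ y ∈ S.carrier, v 0 y = v₀ y

end ClosedSurface

end

/-! Write `A = (∇_Γ X) P` for the matrix of the covariant derivative (`covMat`) and `N_ij = D_i n_j`
(`normalDeriv`). Since `P ∇_Γ X = ∇_Γ X`, one has `2 D_Γ(X) = A + Aᵀ` (`strain_apply`), so the
formula splits into `P div_Γ A = Δ_B X` and `P div_Γ Aᵀ = ∇_Γ div_Γ X + Ric(X)`.

The second identity is pointwise. In `div_Γ Aᵀ` the derivatives `D_i D_j X_i` are interchanged; two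
tangential derivatives commute only up to terms containing `n` and `N` (`tanDeriv_tanDeriv_sub`),
and after projection these terms collect to `(tr N) N X - N² X`. By the Gauss equation
(`curv_apply`) this is also the trace that defines the Ricci curvature, for every orthonormal frame
(`sum_curv_apply`). Everything rests on the symmetry of `N` (`tanDeriv_normal_comm`), which comes
from writing `n` locally as a multiple of the gradient of a level function.

The first identity is Green's formula: `⟨∇X, ∇Y⟩` is the divergence of the tangential field `A Y`
minus `P div_Γ A · Y` (`isCovAdjoint_covTensor`), and a bump function argument shows that the
adjoint is unique (`IsCovAdjoint.eq`). It needs the divergence theorem for the Hausdorff measure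
(`integral_div_eq_zero`). A partition of unity reduces that theorem to one chart, where the area
formula turns the integral into one over the plane, and the integrand is a sum of partial
derivatives of compactly supported functions.

Part (ii) is substitution: when `div_Γ v = 0` on all of `Γ`, the term `∇_Γ div_Γ v` drops out of the
formula. -/

noncomputable section

/-! ### The area formula for injective `C¹` immersions and the Euclidean Hausdorff measure. -/

open Module in
theorem LinearMap.continuous_normDet {E F : Type*} [NormedAddCommGroup E] [InnerProductSpace ℝ E]
    [FiniteDimensional ℝ E] [NormedAddCommGroup F] [InnerProductSpace ℝ F] :
    Continuous fun L : E →L[ℝ] F => L.toLinearMap.normDet := by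
  have h : ∀ L : E →L[ℝ] F, L.toLinearMap.normDet =
      √(Matrix.of fun i j => inner ℝ (L (stdOrthonormalBasis ℝ E i))
        (L (stdOrthonormalBasis ℝ E j))).det := by
    intro L
    have h1 := L.toLinearMap.normDet_sq_eq_det_gram (stdOrthonormalBasis ℝ E)
    rw [← Real.sqrt_sq L.toLinearMap.normDet_nonneg]
    congr 1
  simp_rw [h]
  refine Continuous.sqrt (Continuous.matrix_det ?_)
  refine continuous_matrix fun i j => ?_
  simp only [Matrix.of_apply]
  fun_prop

/-- The bound makes `g ∘ h⁻¹` well defined and `K`-Lipschitz on `h '' A`, even if `h` is not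
injective: points with the same `h`-value have the same `g`-value. It serves to compare the image of
a set under a map with its image under the derivative, in both directions. -/
theorem hausdorffMeasure_image_le_of_edist_le {X Y Z : Type*} [Nonempty X]
    [EMetricSpace Y] [MeasurableSpace Y] [BorelSpace Y]
    [EMetricSpace Z] [MeasurableSpace Z] [BorelSpace Z] {g : X → Y} {h : X → Z} {A : Set X}
    {K : NNReal} (hK : ∀ x ∈ A, ∀ y ∈ A, edist (g x) (g y) ≤ K * edist (h x) (h y)) {d : ℝ}
    (hd : 0 ≤ d) : μH[d] (g '' A) ≤ (K : ENNReal) ^ d * μH[d] (h '' A) := by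
  have hφ : ∀ x ∈ A, g (Function.invFunOn h A (h x)) = g x := by
    intro x hx
    have h1 := Function.invFunOn_mem (f := h) (s := A) ⟨x, hx, rfl⟩
    have h2 := Function.invFunOn_eq (f := h) (s := A) ⟨x, hx, rfl⟩
    have h3 := hK _ h1 x hx
    rw [h2, edist_self, mul_zero] at h3
    exact edist_le_zero.mp h3
  have hL : LipschitzOnWith K (fun z => g (Function.invFunOn h A z)) (h '' A) := by
    rintro _ ⟨x, hx, rfl⟩ _ ⟨y, hy, rfl⟩
    simp only [hφ x hx, hφ y hy]
    exact hK x hx y hy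
  have := hL.hausdorffMeasure_image_le hd
  rw [Set.image_image] at this
  rwa [Set.image_congr hφ] at this

theorem euclideanHausdorffMeasure_image_le_of_edist_le {X Y Z : Type*} [Nonempty X]
    [EMetricSpace Y] [MeasurableSpace Y] [BorelSpace Y]
    [EMetricSpace Z] [MeasurableSpace Z] [BorelSpace Z] {g : X → Y} {h : X → Z} {A : Set X}
    {K : NNReal} (hK : ∀ x ∈ A, ∀ y ∈ A, edist (g x) (g y) ≤ K * edist (h x) (h y)) (d : ℕ) :
    μHE[d] (g '' A) ≤ (K : ENNReal) ^ d * μHE[d] (h '' A) := by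
  have := hausdorffMeasure_image_le_of_edist_le hK (d := d) (by positivity)
  simp_rw [Measure.euclideanHausdorffMeasure_def, Measure.smul_apply,
    Measure.nnreal_smul_coe_apply]
  rw [ENNReal.rpow_natCast] at this
  rw [mul_left_comm]
  gcongr

/-- An injective `L` satisfies `‖v‖ ≤ M ‖L v‖`, so strict differentiability with error constant `(1
- K⁻¹) / M` gives an error of at most `(1 - K⁻¹) ‖L (a - b)‖`, which is relative to the linear map
itself. -/
theorem exists_nhds_edist_comparable {E F : Type*} [NormedAddCommGroup E] [InnerProductSpace ℝ E]
    [FiniteDimensional ℝ E] [NormedAddCommGroup F] [InnerProductSpace ℝ F] {f : E → F} {L : E →L[ℝ] F} {x : E}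
    (hf : HasStrictFDerivAt f L x) (hL : Function.Injective L) {K : NNReal} (hK : 1 < K) :
    ∃ N ∈ 𝓝 x, ∀ a ∈ N, ∀ b ∈ N, edist (f a) (f b) ≤ K * edist (L a) (L b) ∧
      edist (L a) (L b) ≤ K * edist (f a) (f b) := by
  obtain ⟨M, hM0, hM⟩ := L.toLinearMap.exists_antilipschitzWith (LinearMap.ker_eq_bot.mpr hL)
  have hK0 : (0 : ℝ) < K := by
    have : (0 : NNReal) < K := zero_lt_one.trans hK
    exact_mod_cast this
  have hK1 : (1 : ℝ) < K := by exact_mod_cast hK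
  have hM' : (0 : ℝ) < M := by exact_mod_cast hM0
  have hc : 0 < (1 - K⁻¹) * M⁻¹ := by
    have : K⁻¹ < 1 := inv_lt_one_of_one_lt₀ hK
    exact mul_pos (tsub_pos_of_lt this) (inv_pos.mpr hM0)
  obtain ⟨N, hN, happ⟩ := hf.approximates_deriv_on_nhds (c := (1 - K⁻¹) * M⁻¹) (Or.inr hc)
  refine ⟨N, hN, fun a ha b hb => ?_⟩
  have h1 := happ a ha b hb
  have h2 : ‖a - b‖ ≤ M * ‖L (a - b)‖ := by
    have := hM.le_mul_dist a b
    simpa [dist_eq_norm, ← map_sub] using this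
  have hcv : (((1 - K⁻¹) * M⁻¹ : NNReal) : ℝ) = (1 - (K : ℝ)⁻¹) * (M : ℝ)⁻¹ := by
    rw [NNReal.coe_mul, NNReal.coe_sub (inv_le_one_of_one_le₀ hK.le)]
    simp
  rw [hcv] at h1
  have hq : 0 < 1 - (K : ℝ)⁻¹ := sub_pos.mpr (inv_lt_one_of_one_lt₀ hK1)
  have h3 : ‖f a - f b - L (a - b)‖ ≤ (1 - (K : ℝ)⁻¹) * ‖L (a - b)‖ := by
    refine h1.trans ?_
    rw [mul_assoc]
    gcongr
    rwa [inv_mul_le_iff₀ hM']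
  have h4 : ‖f a - f b‖ ≤ K * ‖L (a - b)‖ := by
    have h5 : ‖f a - f b‖ ≤ ‖f a - f b - L (a - b)‖ + ‖L (a - b)‖ := by
      simpa using norm_add_le (f a - f b - L (a - b)) (L (a - b))
    -- The triangle inequality gives the factor `1 + (1 - K⁻¹)`; it is at most `K` because `(K - 1)²
    -- ≥ 0`.
    have h6 : 2 - (K : ℝ)⁻¹ ≤ K := by
      have := mul_inv_cancel₀ hK0.ne'
      nlinarith [sq_nonneg ((K : ℝ) - 1), inv_pos.mpr hK0]
    nlinarith [norm_nonneg (L (a - b))]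
  have h7 : ‖L (a - b)‖ ≤ K * ‖f a - f b‖ := by
    have h5 : ‖L (a - b)‖ ≤ ‖f a - f b‖ + ‖f a - f b - L (a - b)‖ := by
      have := norm_sub_le (f a - f b) (f a - f b - L (a - b))
      simpa using this
    have h6 : (K : ℝ)⁻¹ * ‖L (a - b)‖ ≤ ‖f a - f b‖ := by linarith
    rwa [inv_mul_le_iff₀ hK0] at h6
  rw [map_sub] at h4 h7
  simp only [edist_nndist]
  norm_cast
  simp only [← NNReal.coe_le_coe, NNReal.coe_mul, coe_nndist, dist_eq_norm]
  exact ⟨h4, h7⟩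

section AreaFormula

open Module

variable {E F : Type*} [NormedAddCommGroup E] [InnerProductSpace ℝ E]
    [FiniteDimensional ℝ E] [MeasurableSpace E] [BorelSpace E] [NormedAddCommGroup F]
    [InnerProductSpace ℝ F] [MeasurableSpace F] [BorelSpace F]

variable {f : E → F} {U : Set E}

/-- For the linear map `L` the area formula is exact. Replacing `f` by `L` costs the factor `K ^ d`
in the measure, and freezing the density at `x` costs one more `K`; this is the exponent `d + 1`. -/
theorem exists_isOpen_area_comparable (hU : IsOpen U) (hf : ContDiffOn ℝ 1 f U)
    (hinj : ∀ x ∈ U, Function.Injective (fderiv ℝ f x)) {x : E} (hx : x ∈ U)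
    {K : NNReal} (hK : 1 < K) :
    ∃ N, IsOpen N ∧ x ∈ N ∧ ∀ A ⊆ N, MeasurableSet A →
      μHE[finrank ℝ E] (f '' A) ≤ (K : ENNReal) ^ (finrank ℝ E + 1) *
        ∫⁻ s in A, ENNReal.ofReal (fderiv ℝ f s).toLinearMap.normDet ∧
      ∫⁻ s in A, ENNReal.ofReal (fderiv ℝ f s).toLinearMap.normDet ≤
        (K : ENNReal) ^ (finrank ℝ E + 1) * μHE[finrank ℝ E] (f '' A) := by
  have hUx := hU.mem_nhds hx
  have hstrict := (hf.contDiffAt hUx).hasStrictFDerivAt one_ne_zero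
  obtain ⟨N₁, hN₁, hN⟩ := exists_nhds_edist_comparable hstrict (hinj x hx) hK
  set L := fderiv ℝ f x
  have hcont : ContinuousAt (fun s => (fderiv ℝ f s).toLinearMap.normDet) x :=
    LinearMap.continuous_normDet.continuousAt.comp
      ((hf.continuousOn_fderiv_of_isOpen hU le_rfl).continuousAt hUx)
  have hpos : 0 < L.toLinearMap.normDet :=
    lt_of_le_of_ne L.toLinearMap.normDet_nonneg
      (Ne.symm ((L.toLinearMap.normDet_ne_zero_tfae.out 0 4).mpr (hinj x hx)))
  have hK1 : (1 : ℝ) < K := by exact_mod_cast hK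
  have hK0 : (0 : ℝ) < K := zero_lt_one.trans hK1
  have e1 : ∀ᶠ s in 𝓝 x, (fderiv ℝ f s).toLinearMap.normDet < K * L.toLinearMap.normDet :=
    hcont.eventually (gt_mem_nhds (by nlinarith : L.toLinearMap.normDet < _))
  have e2 : ∀ᶠ s in 𝓝 x, L.toLinearMap.normDet < K * (fderiv ℝ f s).toLinearMap.normDet :=
    (hcont.const_mul (K : ℝ)).eventually (lt_mem_nhds (by
      change L.toLinearMap.normDet < K * L.toLinearMap.normDet; nlinarith))
  obtain ⟨N, hNsub, hNo, hxN⟩ := mem_nhds_iff.mp (inter_mem hN₁ (inter_mem e1 e2))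
  refine ⟨N, hNo, hxN, fun A hA hAm => ?_⟩
  have hJ1 : ∫⁻ s in A, ENNReal.ofReal (fderiv ℝ f s).toLinearMap.normDet ≤
      K * (ENNReal.ofReal L.toLinearMap.normDet * volume A) := by
    rw [← mul_assoc, ← setLIntegral_const]
    refine setLIntegral_mono' hAm fun s hs => ?_
    rw [← ENNReal.ofReal_coe_nnreal, ← ENNReal.ofReal_mul hK0.le]
    exact ENNReal.ofReal_le_ofReal (hNsub (hA hs)).2.1.le
  have hJ2 : ENNReal.ofReal L.toLinearMap.normDet * volume A ≤
      K * ∫⁻ s in A, ENNReal.ofReal (fderiv ℝ f s).toLinearMap.normDet := by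
    rw [← setLIntegral_const, ← lintegral_const_mul' _ _ ENNReal.coe_ne_top]
    refine setLIntegral_mono' hAm fun s hs => ?_
    rw [← ENNReal.ofReal_coe_nnreal, ← ENNReal.ofReal_mul hK0.le]
    exact ENNReal.ofReal_le_ofReal (hNsub (hA hs)).2.2.le
  have hLA : μHE[finrank ℝ E] (L '' A) = ENNReal.ofReal L.toLinearMap.normDet * volume A :=
    L.toLinearMap.euclideanHausdorffMeasure_image_eq_normDet_mul_volume A
  have hm1 : μHE[finrank ℝ E] (f '' A) ≤ (K : ENNReal) ^ finrank ℝ E * μHE[finrank ℝ E] (L '' A) :=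
    euclideanHausdorffMeasure_image_le_of_edist_le
      (fun a ha b hb => (hN a (hNsub (hA ha)).1 b (hNsub (hA hb)).1).1) _
  have hm2 : μHE[finrank ℝ E] (L '' A) ≤ (K : ENNReal) ^ finrank ℝ E * μHE[finrank ℝ E] (f '' A) :=
    euclideanHausdorffMeasure_image_le_of_edist_le
      (fun a ha b hb => (hN a (hNsub (hA ha)).1 b (hNsub (hA hb)).1).2) _
  rw [hLA] at hm1 hm2
  constructor
  · refine hm1.trans ?_
    rw [pow_succ, mul_assoc]
    gcongr
  · refine hJ1.trans ?_
    rw [pow_succ', mul_assoc]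
    gcongr

/-- The area formula for injective immersions of class `C¹`. -/
theorem euclideanHausdorffMeasure_image_eq_lintegral (hU : IsOpen U) (hf : ContDiffOn ℝ 1 f U)
    (hinj : ∀ x ∈ U, Function.Injective (fderiv ℝ f x)) (hfi : Set.InjOn f U)
    {A : Set E} (hA : MeasurableSet A) (hAU : A ⊆ U) :
    μHE[finrank ℝ E] (f '' A) =
      ∫⁻ s in A, ENNReal.ofReal (fderiv ℝ f s).toLinearMap.normDet := by
  set I := ∫⁻ s in A, ENNReal.ofReal (fderiv ℝ f s).toLinearMap.normDet
  -- Two-sided bounds for each `K > 1` suffice, since `K ^ (d + 1)` tends to `1` as `K` decreases to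
  -- `1`.
  have key : ∀ K : NNReal, 1 < K →
      μHE[finrank ℝ E] (f '' A) ≤ (K : ENNReal) ^ (finrank ℝ E + 1) * I ∧
      I ≤ (K : ENNReal) ^ (finrank ℝ E + 1) * μHE[finrank ℝ E] (f '' A) := by
    intro K hK
    rcases A.eq_empty_or_nonempty with rfl | hne
    · simp [I]
    choose! N hNo hxN hN using fun x (hx : x ∈ U) => exists_isOpen_area_comparable hU hf hinj hx hK
    obtain ⟨t, htA, htc, hcov⟩ := TopologicalSpace.countable_cover_nhdsWithin (s := A) (f := N)
      fun x hx => mem_nhdsWithin_of_mem_nhds ((hNo x (hAU hx)).mem_nhds (hxN x (hAU hx)))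
    have htne : t.Nonempty := by
      by_contra h
      rw [Set.not_nonempty_iff_eq_empty] at h
      obtain ⟨a, ha⟩ := hne
      simpa [h] using hcov ha
    obtain ⟨e, rfl⟩ := htc.exists_eq_range htne
    have heU : ∀ k, e k ∈ U := fun k => hAU (htA ⟨k, rfl⟩)
    -- Countably many good neighbourhoods cover `A`. Making them disjoint lets both sides be summed
    -- over the pieces; injectivity of `f` keeps the images disjoint.
    set B : ℕ → Set E := fun k => A ∩ disjointed (fun k => N (e k)) k
    have hBm : ∀ k, MeasurableSet (B k) := fun k =>
      hA.inter (MeasurableSet.disjointed (fun k => (hNo _ (heU k)).measurableSet) k)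
    have hBA : ⋃ k, B k = A := by
      rw [← Set.inter_iUnion, iUnion_disjointed, Set.inter_eq_left]
      simpa using hcov
    have hBd : Pairwise (Function.onFun Disjoint B) := fun i j hij =>
      (disjoint_disjointed _ hij).mono Set.inter_subset_right Set.inter_subset_right
    have hBN : ∀ k, B k ⊆ N (e k) := fun k =>
      Set.inter_subset_right.trans (disjointed_subset _ k)
    have hBU : ∀ k, B k ⊆ U := fun k => Set.inter_subset_left.trans hAU
    have hI : I = ∑' k, ∫⁻ s in B k, ENNReal.ofReal (fderiv ℝ f s).toLinearMap.normDet := by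
      rw [← lintegral_iUnion hBm hBd, hBA]
    have himg : f '' A = ⋃ k, f '' B k := by rw [← Set.image_iUnion, hBA]
    constructor
    · rw [himg, hI, ← ENNReal.tsum_mul_left]
      exact (measure_iUnion_le _).trans
        (ENNReal.tsum_le_tsum fun k => (hN _ (heU k) _ (hBN k) (hBm k)).1)
    · rw [himg, measure_iUnion, hI, ← ENNReal.tsum_mul_left]
      · exact ENNReal.tsum_le_tsum fun k => (hN _ (heU k) _ (hBN k) (hBm k)).2
      · exact fun i j hij => Set.disjoint_image_image fun a ha b hb hab =>
          Set.disjoint_left.mp (hBd hij) ha (hfi (hBU i ha) (hBU j hb) hab ▸ hb)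
      · exact fun k => (hBm k).image_of_continuousOn_injOn (hf.continuousOn.mono (hBU k))
          (hfi.mono (hBU k))
  have hlim : ∀ b : ENNReal, Tendsto (fun K : NNReal => (K : ENNReal) ^ (finrank ℝ E + 1) * b)
      (𝓝[>] 1) (𝓝 b) := by
    intro b
    have h1 : Tendsto (fun K : NNReal => (K : ENNReal) ^ (finrank ℝ E + 1)) (𝓝[>] 1) (𝓝 1) := by
      have : Continuous fun K : NNReal => (K : ENNReal) ^ (finrank ℝ E + 1) := by fun_prop
      simpa using (this.tendsto 1).mono_left nhdsWithin_le_nhds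
    simpa using ENNReal.Tendsto.mul_const h1 (Or.inl one_ne_zero)
  refine le_antisymm ?_ ?_
  · exact ge_of_tendsto (hlim _) (eventually_nhdsWithin_of_forall fun K hK => (key K hK).1)
  · exact ge_of_tendsto (hlim _) (eventually_nhdsWithin_of_forall fun K hK => (key K hK).2)

/-- The area formula as an identity of measures, the form from which the change of variables for
integrals follows. -/
theorem euclideanHausdorffMeasure_restrict_image (hU : IsOpen U) (hf : ContDiffOn ℝ 1 f U)
    (hinj : ∀ x ∈ U, Function.Injective (fderiv ℝ f x)) (hfi : Set.InjOn f U) :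
    (μHE[finrank ℝ E] : Measure F).restrict (f '' U) =
      Measure.map f ((volume.restrict U).withDensity
        fun s => ENNReal.ofReal (fderiv ℝ f s).toLinearMap.normDet) := by
  have hfm : AEMeasurable f (volume.restrict U) := hf.continuousOn.aemeasurable hU.measurableSet
  ext B hB
  have himg : MeasurableSet (f '' U) :=
    hU.measurableSet.image_of_continuousOn_injOn hf.continuousOn hfi
  -- Only the restriction of `f` to `U` is known to be measurable, so the preimage is replaced by a
  -- measurable set with the same trace on `U`.
  obtain ⟨W, hWo, hW⟩ : ∃ W, MeasurableSet W ∧ f ⁻¹' B ∩ U = W ∩ U := by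
    refine ⟨f ⁻¹' B ∩ U, ?_, by simp [Set.inter_assoc]⟩
    have : Measurable (U.domRestrict f) := hf.continuousOn.domRestrict.measurable
    have h2 := hU.measurableSet.subtype_image (this hB)
    convert h2 using 1
    ext x
    simp [Set.domRestrict, and_comm]
  rw [Measure.restrict_apply hB, Measure.map_apply_of_aemeasurable
    (hfm.mono_ac (withDensity_absolutelyContinuous _ _)) hB]
  have hnull : NullMeasurableSet (f ⁻¹' B) (volume.restrict U) := hfm.nullMeasurable hB
  rw [withDensity_apply₀ _ hnull, Measure.restrict_restrict₀ hnull, hW,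
    ← euclideanHausdorffMeasure_image_eq_lintegral hU hf hinj hfi (hWo.inter hU.measurableSet)
      Set.inter_subset_right, ← hW, Set.inter_comm B, ← Set.image_inter_preimage, Set.inter_comm U]

theorem setIntegral_image_euclideanHausdorffMeasure (hU : IsOpen U) (hf : ContDiffOn ℝ 1 f U)
    (hinj : ∀ x ∈ U, Function.Injective (fderiv ℝ f x)) (hfi : Set.InjOn f U)
    {φ : F → ℝ} (hφ : ContinuousOn φ (f '' U)) [SecondCountableTopology F] :
    ∫ y in f '' U, φ y ∂μHE[finrank ℝ E] =
      ∫ s in U, (fderiv ℝ f s).toLinearMap.normDet * φ (f s) := by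
  have himg : MeasurableSet (f '' U) :=
    hU.measurableSet.image_of_continuousOn_injOn hf.continuousOn hfi
  have hres := euclideanHausdorffMeasure_restrict_image hU hf hinj hfi
  have hfm : AEMeasurable f (volume.restrict U) := hf.continuousOn.aemeasurable hU.measurableSet
  have hJm : AEMeasurable (fun s => (fderiv ℝ f s).toLinearMap.normDet) (volume.restrict U) :=
    (LinearMap.continuous_normDet.comp_continuousOn
      (hf.continuousOn_fderiv_of_isOpen hU le_rfl)).aemeasurable hU.measurableSet
  have hφm : AEStronglyMeasurable φ ((μHE[finrank ℝ E] : Measure F).restrict (f '' U)) :=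
    hφ.aestronglyMeasurable himg
  rw [hres] at hφm ⊢
  rw [integral_map (hfm.mono_ac (withDensity_absolutelyContinuous _ _)) hφm,
    integral_withDensity_eq_integral_toReal_smul₀ hJm.ennreal_ofReal (by simp)]
  simp [ENNReal.toReal_ofReal, LinearMap.normDet_nonneg]

end AreaFormula

/-! ### Calculus of germs of `C^m` functions on a set. -/

/-- `η` is of class `C^m` on the germ of the set `A` at `y`. -/
def IsCmAt {F : Type*} [NormedAddCommGroup F] [NormedSpace ℝ F]
    (m : ℕ) (η : R3 → F) (A : Set R3) (y : R3) : Prop :=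
  ∃ η' : R3 → F, ContDiffAt ℝ m η' y ∧ η' =ᶠ[𝓝[A] y] η

namespace IsCmAt

variable {F G : Type*} [NormedAddCommGroup F] [NormedSpace ℝ F] [NormedAddCommGroup G]
  [NormedSpace ℝ G] {m k : ℕ} {η ζ : R3 → F} {a b : R3 → ℝ} {A : Set R3} {y : R3}

theorem of_contDiffAt (h : ContDiffAt ℝ m η y) : IsCmAt m η A y := ⟨η, h, EventuallyEq.rfl⟩

theorem congr (h : IsCmAt m η A y) (he : η =ᶠ[𝓝[A] y] ζ) : IsCmAt m ζ A y := by
  obtain ⟨η', h1, h2⟩ := h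
  exact ⟨η', h1, h2.trans he⟩

theorem mono (h : IsCmAt m η A y) (hk : k ≤ m) : IsCmAt k η A y := by
  obtain ⟨η', h1, h2⟩ := h
  exact ⟨η', h1.of_le (by exact_mod_cast hk), h2⟩

theorem mono_set {B : Set R3} (h : IsCmAt m η A y) (hBA : 𝓝[B] y ≤ 𝓝[A] y) : IsCmAt m η B y := by
  obtain ⟨η', h1, h2⟩ := h
  exact ⟨η', h1, h2.filter_mono hBA⟩

theorem const (c : F) : IsCmAt m (fun _ => c) A y := of_contDiffAt contDiffAt_const

theorem comp {Ψ : F → G} (h : IsCmAt m η A y) (hy : y ∈ A) (hΨ : ContDiffAt ℝ m Ψ (η y)) :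
    IsCmAt m (fun z => Ψ (η z)) A y := by
  obtain ⟨η', h1, h2⟩ := h
  refine ⟨fun z => Ψ (η' z), ?_, h2.mono fun z hz => by simp only [hz]⟩
  rw [← h2.eq_of_nhdsWithin hy] at hΨ
  exact hΨ.comp y h1

theorem clm (L : F →L[ℝ] G) (h : IsCmAt m η A y) : IsCmAt m (fun z => L (η z)) A y := by
  obtain ⟨η', h1, h2⟩ := h
  exact ⟨fun z => L (η' z), L.contDiff.contDiffAt.comp y h1, h2.mono fun z hz => by simp only [hz]⟩

theorem add (h : IsCmAt m η A y) (h' : IsCmAt m ζ A y) : IsCmAt m (fun z => η z + ζ z) A y := by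
  obtain ⟨η', h1, h2⟩ := h
  obtain ⟨ζ', h3, h4⟩ := h'
  refine ⟨fun z => η' z + ζ' z, h1.add h3, ?_⟩
  filter_upwards [h2, h4] with z hz hz'
  rw [hz, hz']

theorem sub (h : IsCmAt m η A y) (h' : IsCmAt m ζ A y) : IsCmAt m (fun z => η z - ζ z) A y := by
  obtain ⟨η', h1, h2⟩ := h
  obtain ⟨ζ', h3, h4⟩ := h'
  refine ⟨fun z => η' z - ζ' z, h1.sub h3, ?_⟩
  filter_upwards [h2, h4] with z hz hz'
  rw [hz, hz']

theorem smul (h : IsCmAt m a A y) (h' : IsCmAt m ζ A y) : IsCmAt m (fun z => a z • ζ z) A y := by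
  obtain ⟨η', h1, h2⟩ := h
  obtain ⟨ζ', h3, h4⟩ := h'
  refine ⟨fun z => η' z • ζ' z, h1.smul h3, ?_⟩
  filter_upwards [h2, h4] with z hz hz'
  rw [hz, hz']

theorem mul (h : IsCmAt m a A y) (h' : IsCmAt m b A y) : IsCmAt m (fun z => a z * b z) A y :=
  h.smul h'

theorem neg (h : IsCmAt m η A y) : IsCmAt m (fun z => -η z) A y := by
  simpa using (const (0 : F)).sub h

theorem sum {ι : Type*} {s : Finset ι} {η : ι → R3 → F} (h : ∀ i ∈ s, IsCmAt m (η i) A y) :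
    IsCmAt m (fun z => ∑ i ∈ s, η i z) A y := by
  classical
  induction s using Finset.induction_on with
  | empty => simpa using const 0
  | insert i s hi ih =>
    simp only [Finset.sum_insert hi]
    exact (h i (Finset.mem_insert_self i s)).add
      (ih fun j hj => h j (Finset.mem_insert_of_mem hj))

theorem coord {X : R3 → R3} (h : IsCmAt m X A y) (i : Fin 3) : IsCmAt m (fun z => X z i) A y :=
  h.clm (EuclideanSpace.proj i : R3 →L[ℝ] ℝ)

theorem of_coord {X : R3 → R3} (h : ∀ i, IsCmAt m (fun z => X z i) A y) : IsCmAt m X A y := by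
  choose η' h1 h2 using h
  refine ⟨fun z => WithLp.toLp 2 fun i => η' i z, ?_, ?_⟩
  · rw [contDiffAt_euclidean]
    exact h1
  · filter_upwards [eventually_all.mpr h2] with z hz
    ext i
    exact hz i

theorem eventually (h : IsCmAt m η A y) : ∀ᶠ z in 𝓝[A] y, IsCmAt m η A z := by
  obtain ⟨η', h1, h2⟩ := h
  have h3 : ∀ᶠ z in 𝓝[A] y, ContDiffAt ℝ m η' z :=
    (h1.eventually (by simp)).filter_mono nhdsWithin_le_nhds
  filter_upwards [h3, eventually_eventually_nhdsWithin.mpr h2] with z hz hz'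
  exact ⟨η', hz, hz'⟩

theorem continuousWithinAt (h : IsCmAt m η A y) (hy : y ∈ A) : ContinuousWithinAt η A y := by
  obtain ⟨η', h1, h2⟩ := h
  exact h1.continuousAt.continuousWithinAt.congr_of_eventuallyEq h2.symm
    (h2.eq_of_nhdsWithin hy).symm

end IsCmAt

theorem IsCmOn.continuousOn {F : Type*} [NormedAddCommGroup F] [NormedSpace ℝ F] {m : ℕ}
    {η : R3 → F} {A : Set R3} (h : IsCmOn m η A) : ContinuousOn η A :=
  fun y hy => IsCmAt.continuousWithinAt (h y hy) hy

theorem nhdsWithin_inter_isOpen {A V : Set R3} (hV : IsOpen V) {y : R3} (hy : y ∈ V) :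
    𝓝[A ∩ V] y = 𝓝[A] y :=
  nhdsWithin_inter_of_mem' (mem_nhdsWithin_of_mem_nhds (hV.mem_nhds hy))

/-! ### Rules of calculus for the tangential derivatives. -/

namespace ClosedSurface

variable {l : ℕ} (S : ClosedSurface l)

theorem sum_normal_mul_self {y : R3} (hy : y ∈ S.carrier) :
    ∑ k, S.normal y k * S.normal y k = 1 := by
  have := EuclideanSpace.real_norm_sq_eq (S.normal y)
  rw [S.norm_normal y hy] at this
  simpa [pow_two] using this.symm

variable {y : R3} {η ζ : R3 → ℝ} {i : Fin 3}

theorem tanDeriv_congr (hy : y ∈ S.carrier) (h : η =ᶠ[𝓝[S.carrier] y] ζ) :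
    S.tanDeriv i η y = S.tanDeriv i ζ y := by
  unfold tanDeriv
  rw [h.fderivWithin_eq (h.eq_of_nhdsWithin hy)]

/-- With `P` expanded, identities between tangential derivatives become polynomial identities in `n`
and the partial derivatives of an extension. -/
theorem tanDeriv_eq_sub (hl : 1 ≤ l) {η' : R3 → ℝ} (hy : y ∈ S.carrier)
    (hη' : ContDiffAt ℝ 1 η' y) (h : η' =ᶠ[𝓝[S.carrier] y] η) :
    S.tanDeriv i η y = fderiv ℝ η' y (EuclideanSpace.single i 1) -
      S.normal y i * ∑ k, S.normal y k * fderiv ℝ η' y (EuclideanSpace.single k 1) := by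
  rw [S.tanDeriv_eq hl i η η' hy (hη'.differentiableAt one_ne_zero) h]
  simp only [P, Matrix.of_apply, sub_mul, Finset.sum_sub_distrib, ite_mul, one_mul, zero_mul,
    Finset.sum_ite_eq, Finset.mem_univ, if_true, Finset.mul_sum, mul_assoc]

theorem tanDeriv_const (hl : 1 ≤ l) (hy : y ∈ S.carrier) (c : ℝ) :
    S.tanDeriv i (fun _ => c) y = 0 := by
  simp [S.tanDeriv_eq_sub hl hy contDiffAt_const EventuallyEq.rfl]

theorem tanDeriv_add (hl : 1 ≤ l) (hy : y ∈ S.carrier) (hη : IsCmAt 1 η S.carrier y)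
    (hζ : IsCmAt 1 ζ S.carrier y) :
    S.tanDeriv i (fun z => η z + ζ z) y = S.tanDeriv i η y + S.tanDeriv i ζ y := by
  obtain ⟨η', h1, h2⟩ := hη
  obtain ⟨ζ', h3, h4⟩ := hζ
  have h5 : (fun z => η' z + ζ' z) =ᶠ[𝓝[S.carrier] y] fun z => η z + ζ z := h2.add h4
  norm_cast at h1 h3
  rw [S.tanDeriv_eq_sub hl hy (h1.add h3) h5, S.tanDeriv_eq_sub hl hy h1 h2,
    S.tanDeriv_eq_sub hl hy h3 h4,
    fderiv_fun_add (h1.differentiableAt one_ne_zero) (h3.differentiableAt one_ne_zero)]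
  simp only [add_apply, mul_add, Finset.sum_add_distrib]
  ring

theorem tanDeriv_mul (hl : 1 ≤ l) (hy : y ∈ S.carrier) (hη : IsCmAt 1 η S.carrier y)
    (hζ : IsCmAt 1 ζ S.carrier y) :
    S.tanDeriv i (fun z => η z * ζ z) y = S.tanDeriv i η y * ζ y + η y * S.tanDeriv i ζ y := by
  obtain ⟨η', h1, h2⟩ := hη
  obtain ⟨ζ', h3, h4⟩ := hζ
  have h5 : (fun z => η' z * ζ' z) =ᶠ[𝓝[S.carrier] y] fun z => η z * ζ z := h2.mul h4
  norm_cast at h1 h3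
  rw [S.tanDeriv_eq_sub hl hy (h1.mul h3) h5, S.tanDeriv_eq_sub hl hy h1 h2,
    S.tanDeriv_eq_sub hl hy h3 h4,
    fderiv_fun_mul (h1.differentiableAt one_ne_zero) (h3.differentiableAt one_ne_zero),
    ← h2.eq_of_nhdsWithin hy, ← h4.eq_of_nhdsWithin hy]
  simp only [add_apply, smul_apply, smul_eq_mul, mul_add,
    Finset.sum_add_distrib, Fin.sum_univ_three]
  ring

theorem tanDeriv_neg (hl : 1 ≤ l) (hy : y ∈ S.carrier) (hη : IsCmAt 1 η S.carrier y) :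
    S.tanDeriv i (fun z => -η z) y = -S.tanDeriv i η y := by
  have := S.tanDeriv_mul (i := i) hl hy (IsCmAt.const (-1 : ℝ)) hη
  simpa [S.tanDeriv_const hl hy] using this

theorem tanDeriv_sub (hl : 1 ≤ l) (hy : y ∈ S.carrier) (hη : IsCmAt 1 η S.carrier y)
    (hζ : IsCmAt 1 ζ S.carrier y) :
    S.tanDeriv i (fun z => η z - ζ z) y = S.tanDeriv i η y - S.tanDeriv i ζ y := by
  simpa [sub_eq_add_neg, S.tanDeriv_neg hl hy hζ] using
    S.tanDeriv_add (i := i) hl hy hη hζ.neg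

theorem tanDeriv_sum (hl : 1 ≤ l) (hy : y ∈ S.carrier) {ι : Type*} {s : Finset ι}
    {η : ι → R3 → ℝ} (hη : ∀ j ∈ s, IsCmAt 1 (η j) S.carrier y) :
    S.tanDeriv i (fun z => ∑ j ∈ s, η j z) y = ∑ j ∈ s, S.tanDeriv i (η j) y := by
  classical
  induction s using Finset.induction_on with
  | empty => simpa using S.tanDeriv_const hl hy 0
  | insert j s hj ih =>
    simp only [Finset.sum_insert hj]
    rw [S.tanDeriv_add hl hy (hη j (Finset.mem_insert_self j s))
      (IsCmAt.sum fun k hk => hη k (Finset.mem_insert_of_mem hk)),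
      ih fun k hk => hη k (Finset.mem_insert_of_mem hk)]

/-- This is `P n = 0`. No regularity of `η` enters, because `P` is applied to whatever
`fderivWithin` returns. -/
theorem sum_normal_mul_tanDeriv (hy : y ∈ S.carrier) (η : R3 → ℝ) :
    ∑ i, S.normal y i * S.tanDeriv i η y = 0 := by
  have h := S.sum_normal_mul_self hy
  simp only [tanDeriv, P, Matrix.of_apply, Fin.sum_univ_three] at h ⊢
  simp
  set a := fderivWithin ℝ η S.carrier y
  linear_combination (-(S.normal y 0 * a (EuclideanSpace.single 0 1)) -
    S.normal y 1 * a (EuclideanSpace.single 1 1) -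
    S.normal y 2 * a (EuclideanSpace.single 2 1)) * h

/-- A surface of class `C^l` is locally contained in the zero set of a submersion. -/
theorem exists_level_function (hl : 1 ≤ l) (hy : y ∈ S.carrier) :
    ∃ F : R3 → ℝ, ContDiffAt ℝ l F y ∧ fderiv ℝ F y ≠ 0 ∧ ∀ᶠ z in 𝓝[S.carrier] y, F z = 0 := by
  obtain ⟨U, μ, hμ, s, hs, rfl⟩ := S.exists_param y hy
  set n₀ := S.normal (μ s)
  have hl' : (l : WithTop ℕ∞) ≠ 0 := by
    have : l ≠ 0 := by omega
    exact_mod_cast this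
  have hμs : ContDiffAt ℝ l μ s := hμ.contDiffOn.contDiffAt (hμ.isOpen_source.mem_nhds hs)
  -- Translating along the fixed vector `n₀` keeps `Φ` of class `C^l`, whereas the normal field
  -- along `μ` would cost one derivative. The level function is the second component of the local
  -- inverse of `Φ`.
  let Φ : R2 × ℝ → R3 := fun p => μ p.1 + p.2 • n₀
  have hΦ : ContDiffAt ℝ l Φ (s, 0) :=
    (hμs.comp (s, (0 : ℝ)) contDiffAt_fst).add (contDiffAt_snd.smul contDiffAt_const)
  let L : R2 × ℝ →L[ℝ] R3 := (fderiv ℝ μ s).comp (ContinuousLinearMap.fst ℝ R2 ℝ) +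
    (ContinuousLinearMap.snd ℝ R2 ℝ).smulRight n₀
  have hL : HasFDerivAt Φ L (s, 0) := by
    refine HasFDerivAt.add ?_ ?_
    · exact HasFDerivAt.comp (s, (0 : ℝ)) (hμs.differentiableAt hl').hasFDerivAt hasFDerivAt_fst
    · exact (hasFDerivAt_snd (𝕜 := ℝ) (p := (s, (0 : ℝ)))).smul_const n₀
  have hn1 : inner ℝ n₀ n₀ = (1 : ℝ) := by
    rw [real_inner_self_eq_norm_sq, S.norm_normal _ hy, one_pow]
  have hinj : Function.Injective L.toLinearMap := by
    rw [← LinearMap.ker_eq_bot, LinearMap.ker_eq_bot']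
    rintro ⟨w, t⟩ h
    have h0 : fderiv ℝ μ s w + t • n₀ = 0 := h
    have ht : t = 0 := by
      have := congrArg (fun v => inner ℝ n₀ v) h0
      simpa only [inner_add_right, inner_smul_right, hn1, n₀, S.normal_orthogonal U μ hμ s hs w,
        inner_zero_right, zero_add, mul_one] using this
    subst ht
    have hw : w = 0 := hμ.injective_fderiv s hs (by simpa using h0)
    rw [hw]
    rfl
  have hfr : Module.finrank ℝ (R2 × ℝ) = Module.finrank ℝ R3 := by simp
  let Le : (R2 × ℝ) ≃L[ℝ] R3 := (LinearEquiv.ofInjectiveOfFinrankEq L.toLinearMap hinj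
    hfr).toContinuousLinearEquiv
  have hLe : HasFDerivAt Φ (Le : R2 × ℝ →L[ℝ] R3) (s, 0) := by
    have : (Le : R2 × ℝ →L[ℝ] R3) = L := by
      ext1
      · rfl
      · rfl
    rwa [this]
  let Ψ := hΦ.localInverse hLe hl'
  have hΦs : Φ (s, 0) = μ s := by simp [Φ]
  have hΨ : ContDiffAt ℝ l Ψ (μ s) := hΦs ▸ hΦ.to_localInverse hLe hl'
  have hleft : ∀ᶠ p in 𝓝 (s, (0 : ℝ)), Ψ (Φ p) = p :=
    (hΦ.hasStrictFDerivAt' hLe hl').eventually_left_inverse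
  refine ⟨fun z => (Ψ z).2, contDiffAt_snd.comp (μ s) hΨ, ?_, ?_⟩
  · intro h0
    have hF : HasFDerivAt (fun z => (Ψ z).2) (0 : R3 →L[ℝ] ℝ) (Φ (s, 0)) := by
      rw [hΦs, ← h0]
      exact (((contDiffAt_snd.comp (μ s) hΨ).differentiableAt hl').hasFDerivAt)
    have h1 : HasFDerivAt (fun p => (Ψ (Φ p)).2) (0 : R2 × ℝ →L[ℝ] ℝ) (s, 0) := by
      have h2 := hF.comp (s, (0 : ℝ)) hL
      rwa [ContinuousLinearMap.zero_comp] at h2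
    have h2 : HasFDerivAt (fun p => (Ψ (Φ p)).2) (ContinuousLinearMap.snd ℝ R2 ℝ) (s, 0) :=
      hasFDerivAt_snd.congr_of_eventuallyEq (hleft.mono fun p hp => by simp only [hp])
    have := congrArg (fun M : R2 × ℝ →L[ℝ] ℝ => M (0, 1)) (h1.unique h2)
    simp at this
  · obtain ⟨V, hV, hUV⟩ := hμ.exists_isOpen_image
    obtain ⟨σ, hσ, hσμ⟩ := hμ.exists_continuous_inverse
    have hyV : μ s ∈ V := (hUV ▸ Set.mem_image_of_mem μ hs : μ s ∈ S.carrier ∩ V).2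
    -- Continuity of the inverse chart excludes other sheets of `Γ`: points of `Γ` near `μ s` have
    -- parameters near `s`, where the local inverse of `Φ` is valid.
    have hσc : Tendsto (fun z => (σ z, (0 : ℝ))) (𝓝[S.carrier] (μ s)) (𝓝 (s, 0)) := by
      rw [← nhdsWithin_inter_isOpen hV hyV, ← hUV]
      have h1 := hσ (μ s) (Set.mem_image_of_mem μ hs)
      rw [ContinuousWithinAt, hσμ s hs] at h1
      exact h1.prodMk_nhds tendsto_const_nhds
    have hmem : ∀ᶠ z in 𝓝[S.carrier] (μ s), z ∈ μ '' U := by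
      rw [hUV]
      filter_upwards [self_mem_nhdsWithin, mem_nhdsWithin_of_mem_nhds (hV.mem_nhds hyV)]
        with z h1 h2 using ⟨h1, h2⟩
    filter_upwards [hσc.eventually hleft, hmem] with z hz hzU
    obtain ⟨s', hs', rfl⟩ := hzU
    rw [hσμ s' hs'] at hz
    have : Φ (s', 0) = μ s' := by simp [Φ]
    rw [this] at hz
    rw [hz]

end ClosedSurface

theorem ContDiffAt.fderiv_single {m : ℕ} {F : R3 → ℝ} {y : R3} (hF : ContDiffAt ℝ (m + 1 : ℕ) F y)
    (i : Fin 3) : ContDiffAt ℝ m (fun z => fderiv ℝ F z (EuclideanSpace.single i 1)) y :=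
  (hF.fderiv_right (m := m) (by norm_cast)).clm_apply contDiffAt_const

/-! ### Regularity of the normal, symmetry of the Weingarten map, the commutator of tangential
derivatives. -/

namespace ClosedSurface

section General

variable {l : ℕ} (S : ClosedSurface l) {y : R3} {η ζ : R3 → ℝ} {i : Fin 3}

theorem eventually_tanDeriv_eq_sub (hl : 1 ≤ l) {η' : R3 → ℝ}
    (hη' : ContDiffAt ℝ 1 η' y) (h : η' =ᶠ[𝓝[S.carrier] y] η) :
    ∀ᶠ z in 𝓝[S.carrier] y, ∀ i, S.tanDeriv i η z = fderiv ℝ η' z (EuclideanSpace.single i 1) -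
      S.normal z i * ∑ k, S.normal z k * fderiv ℝ η' z (EuclideanSpace.single k 1) := by
  filter_upwards [(hη'.eventually (by simp)).filter_mono nhdsWithin_le_nhds,
    eventually_eventually_nhdsWithin.mpr h, self_mem_nhdsWithin] with z h1 h2 h3 i
  exact S.tanDeriv_eq_sub hl h3 h1 h2

/-- A level function vanishes on `Γ`, so its tangential gradient is zero and `∇F` is parallel to
`n`. Hence `n = ± ∇F / |∇F|`, and the sign is locally constant because `n` is continuous. Both the
regularity of `n` and the symmetry of its derivative are read off from this form. -/
theorem normal_eq_smul_fderiv (hl : 1 ≤ l) (hy : y ∈ S.carrier) :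
    ∃ (F : R3 → ℝ) (a : R3 → ℝ), ContDiffAt ℝ l F y ∧ ContDiffAt ℝ (l - 1 : ℕ) a y ∧
      ∀ᶠ z in 𝓝[S.carrier] y, ∀ i,
        S.normal z i = a z * fderiv ℝ F z (EuclideanSpace.single i 1) := by
  obtain ⟨F, hF, hF0, hFΓ⟩ := S.exists_level_function hl hy
  have hF' : ContDiffAt ℝ ((l - 1) + 1 : ℕ) F y := by
    rwa [Nat.sub_add_cancel hl]
  let g : R3 → R3 := fun z => WithLp.toLp 2 fun i => fderiv ℝ F z (EuclideanSpace.single i 1)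
  have hg : ContDiffAt ℝ (l - 1 : ℕ) g y := by
    rw [contDiffAt_euclidean]
    exact fun i => hF'.fderiv_single i
  have hg0 : g y ≠ 0 := by
    intro h
    apply hF0
    ext v
    have hv : v = ∑ i, v i • EuclideanSpace.single i (1 : ℝ) := by
      ext j
      fin_cases j <;> simp [Fin.sum_univ_three]
    rw [hv, map_sum]
    refine Finset.sum_eq_zero fun i _ => ?_
    have : g y i = 0 := by rw [h]; rfl
    rw [map_smul]
    exact (congrArg (v i • ·) this).trans (smul_zero _)
  let c : R3 → ℝ := fun z => ∑ k, S.normal z k * g z k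
  have hgc : ∀ᶠ z in 𝓝[S.carrier] y, g z = c z • S.normal z := by
    have h1 := S.eventually_tanDeriv_eq_sub hl (hF.of_le (by exact_mod_cast hl)) (η := fun _ => 0)
      hFΓ
    filter_upwards [h1, self_mem_nhdsWithin] with z hz hzΓ
    ext i
    have := hz i
    rw [S.tanDeriv_const hl hzΓ] at this
    simp only [PiLp.smul_apply, smul_eq_mul]
    change fderiv ℝ F z (EuclideanSpace.single i 1) =
      (∑ k, S.normal z k * fderiv ℝ F z (EuclideanSpace.single k 1)) * S.normal z i
    linarith
  have hnc : ∀ k, ContinuousWithinAt (fun z => S.normal z k) S.carrier y := fun k =>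
    (EuclideanSpace.proj k : R3 →L[ℝ] ℝ).continuous.continuousAt.comp_continuousWithinAt
      (S.continuousOn_normal y hy)
  have hgk : ∀ k, ContinuousWithinAt (fun z => g z k) S.carrier y := fun k =>
    (EuclideanSpace.proj k : R3 →L[ℝ] ℝ).continuous.continuousAt.comp_continuousWithinAt
      hg.continuousAt.continuousWithinAt
  have hc : ContinuousWithinAt c S.carrier y :=
    tendsto_finsetSum _ fun k _ => (hnc k).mul (hgk k)
  have hnorm : ∀ᶠ z in 𝓝[S.carrier] y, ‖g z‖ = |c z| := by
    filter_upwards [hgc, self_mem_nhdsWithin] with z hz hzΓ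
    rw [hz, norm_smul, S.norm_normal z hzΓ, mul_one, Real.norm_eq_abs]
  have hcy : c y ≠ 0 := by
    intro h
    have := hgc.self_of_nhdsWithin hy
    rw [h, zero_smul] at this
    exact hg0 this
  have hinv : ContDiffAt ℝ (l - 1 : ℕ) (fun z => ‖g z‖⁻¹) y :=
    (hg.norm ℝ hg0).inv (norm_ne_zero_iff.mpr hg0)
  have hfin : ∀ z, g z = c z • S.normal z → c z ≠ 0 → ∀ i,
      S.normal z i = (c z)⁻¹ * fderiv ℝ F z (EuclideanSpace.single i 1) := by
    intro z hz hcz i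
    have : g z i = c z * S.normal z i := by
      conv_lhs => rw [hz]
      rfl
    rw [eq_inv_mul_iff_mul_eq₀ hcz, ← this]
  rcases hcy.lt_or_gt with h | h
  · refine ⟨F, fun z => -‖g z‖⁻¹, hF, hinv.neg, ?_⟩
    filter_upwards [hgc, hnorm, hc.eventually (gt_mem_nhds h)] with z h1 h2 h3
    simpa [h2, abs_of_neg h3, ← inv_neg] using hfin z h1 h3.ne
  · refine ⟨F, fun z => ‖g z‖⁻¹, hF, hinv, ?_⟩
    filter_upwards [hgc, hnorm, hc.eventually (lt_mem_nhds h)] with z h1 h2 h3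
    simpa [h2, abs_of_pos h3] using hfin z h1 h3.ne'

/-- The unit normal of a surface of class `C^(m+1)` is of class `C^m`. -/
theorem isCmAt_normal {m : ℕ} (hm : m + 1 ≤ l) (hy : y ∈ S.carrier) :
    IsCmAt m S.normal S.carrier y := by
  obtain ⟨F, a, hF, ha, h⟩ := S.normal_eq_smul_fderiv (le_trans (by omega) hm) hy
  refine IsCmAt.of_coord fun i =>
    ⟨fun z => a z * fderiv ℝ F z (EuclideanSpace.single i 1), ?_, ?_⟩
  · refine (ha.of_le (by exact_mod_cast (by omega : m ≤ l - 1))).mul ?_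
    exact (hF.of_le (m := (m + 1 : ℕ)) (by exact_mod_cast hm)).fderiv_single i
  · filter_upwards [h] with z hz using (hz i).symm

theorem isCmAt_normal_apply {m : ℕ} (hm : m + 1 ≤ l) (hy : y ∈ S.carrier) (i : Fin 3) :
    IsCmAt m (fun z => S.normal z i) S.carrier y :=
  (S.isCmAt_normal hm hy).coord i

theorem isCmAt_tanDeriv {m : ℕ} (hm : m + 1 ≤ l) (hy : y ∈ S.carrier)
    (hη : IsCmAt (m + 1) η S.carrier y) (i : Fin 3) :
    IsCmAt m (S.tanDeriv i η) S.carrier y := by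
  obtain ⟨η', h1, h2⟩ := hη
  have h3 := S.eventually_tanDeriv_eq_sub (by omega)
    (h1.of_le (by exact_mod_cast Nat.le_add_left 1 m)) h2
  have hd : ∀ k, IsCmAt m (fun z => fderiv ℝ η' z (EuclideanSpace.single k 1)) S.carrier y :=
    fun k => IsCmAt.of_contDiffAt (h1.fderiv_single k)
  have hn := S.isCmAt_normal_apply hm hy
  exact ((hd i).sub ((hn i).mul (IsCmAt.sum fun k _ => (hn k).mul (hd k)))).congr
    (h3.mono fun z hz => (hz i).symm)

/-- Differentiate `|n|² = 1` along the surface. -/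
theorem tanDeriv_normal_mul_normal (hl : 2 ≤ l) (hy : y ∈ S.carrier) (i : Fin 3) :
    ∑ k, S.tanDeriv i (fun z => S.normal z k) y * S.normal y k = 0 := by
  have h1 : S.tanDeriv i (fun z => ∑ k, S.normal z k * S.normal z k) y = 0 := by
    rw [S.tanDeriv_congr hy (ζ := fun _ => 1), S.tanDeriv_const (by omega) hy]
    filter_upwards [self_mem_nhdsWithin] with z hz using S.sum_normal_mul_self hz
  have hn := S.isCmAt_normal_apply (m := 1) hl hy
  rw [S.tanDeriv_sum (by omega) hy fun k _ => (hn k).mul (hn k)] at h1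
  simp only [S.tanDeriv_mul (by omega : 1 ≤ l) hy (hn _) (hn _), Fin.sum_univ_three] at h1 ⊢
  linarith

/-- The Weingarten map is symmetric. -/
theorem tanDeriv_normal_comm (hl : 2 ≤ l) (hy : y ∈ S.carrier) (i j : Fin 3) :
    S.tanDeriv i (fun z => S.normal z j) y = S.tanDeriv j (fun z => S.normal z i) y := by
  obtain ⟨F, a, hF, ha, h⟩ := S.normal_eq_smul_fderiv (by omega : 1 ≤ l) hy
  have hl1 : 1 ≤ l := by omega
  have hF2 : ContDiffAt ℝ (1 + 1 : ℕ) F y := hF.of_le (by exact_mod_cast hl)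
  have hG : ∀ j, ContDiffAt ℝ (1 : ℕ) (fun z => fderiv ℝ F z (EuclideanSpace.single j 1)) y :=
    fun j => hF2.fderiv_single j
  have haC : IsCmAt 1 a S.carrier y :=
    IsCmAt.of_contDiffAt (ha.of_le (by exact_mod_cast (by omega : 1 ≤ l - 1)))
  set H : Fin 3 → Fin 3 → ℝ := fun i j =>
    fderiv ℝ (fun z => fderiv ℝ F z (EuclideanSpace.single j 1)) y (EuclideanSpace.single i 1)
  have hH : ∀ i j, H i j = H j i := by
    intro i j
    have hs : IsSymmSndFDerivAt ℝ F y := hF2.isSymmSndFDerivAt (by simp)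
    have hd : DifferentiableAt ℝ (fderiv ℝ F) y :=
      (hF2.fderiv_right (m := 1) (by norm_cast)).differentiableAt one_ne_zero
    have he : ∀ i j, H i j =
        fderiv ℝ (fderiv ℝ F) y (EuclideanSpace.single i 1) (EuclideanSpace.single j 1) := by
      intro i j
      simp only [H]
      rw [fderiv_clm_apply hd (differentiableAt_const _)]
      simp
    rw [he, he, hs]
  have hN : ∀ i j, S.tanDeriv i (fun z => S.normal z j) y =
      S.tanDeriv i a y * fderiv ℝ F y (EuclideanSpace.single j 1) +
        a y * (H i j - S.normal y i * ∑ k, S.normal y k * H k j) := by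
    intro i j
    rw [S.tanDeriv_congr hy (h.mono fun z hz => hz j),
      S.tanDeriv_mul hl1 hy haC (IsCmAt.of_contDiffAt (hG j)),
      S.tanDeriv_eq_sub hl1 hy (hG j) EventuallyEq.rfl]
  have hn : ∀ j, S.normal y j = a y * fderiv ℝ F y (EuclideanSpace.single j 1) :=
    h.self_of_nhdsWithin hy
  have h1 := S.sum_normal_mul_self hy
  have ha0 : a y ≠ 0 := by
    intro h0
    simp [hn, h0] at h1
  have hx := fun i => S.tanDeriv_normal_mul_normal hl hy i
  set N : Fin 3 → Fin 3 → ℝ := fun i j => S.tanDeriv i (fun z => S.normal z j) y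
  set x : Fin 3 → ℝ := fun i => S.tanDeriv i a y
  have haN : ∀ i j, a y * N i j = x i * S.normal y j +
      a y ^ 2 * (H i j - S.normal y i * ∑ k, S.normal y k * H k j) := by
    intro i j
    simp only [N, hN i j, hn j, x]
    ring
  -- Contracting `haN` with `n` and using `N n = 0` determines the derivative of the factor `a`.
  -- Inserted back, it gives `N = a P H P`, which is symmetric with the Hessian `H`.
  have hxi : ∀ i, x i = -(a y ^ 2 * (∑ j, H i j * S.normal y j -
      S.normal y i * ∑ j, ∑ k, S.normal y k * H k j * S.normal y j)) := by
    intro i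
    have e := hx i
    simp only [Fin.sum_univ_three] at e h1 haN ⊢
    change N i 0 * _ + N i 1 * _ + N i 2 * _ = 0 at e
    linear_combination (-x i) * h1 + a y * e - S.normal y 0 * haN i 0
      - S.normal y 1 * haN i 1 - S.normal y 2 * haN i 2
  change N i j = N j i
  have e : a y * N i j = a y * N j i := by
    rw [haN, haN, hxi, hxi]
    simp only [Fin.sum_univ_three, hH i j, hH 0 i, hH 1 i, hH 2 i, hH 0 j, hH 1 j, hH 2 j]
    ring
  exact mul_left_cancel₀ ha0 e

/-- The commutator of two tangential derivatives. -/
theorem tanDeriv_tanDeriv_sub (hl : 2 ≤ l) (hy : y ∈ S.carrier) (hη : IsCmAt 2 η S.carrier y)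
    (i j : Fin 3) :
    S.tanDeriv i (S.tanDeriv j η) y - S.tanDeriv j (S.tanDeriv i η) y =
      S.normal y i * ∑ k, S.tanDeriv j (fun z => S.normal z k) y * S.tanDeriv k η y -
      S.normal y j * ∑ k, S.tanDeriv i (fun z => S.normal z k) y * S.tanDeriv k η y := by
  obtain ⟨η', h1, h2⟩ := hη
  have hl1 : 1 ≤ l := by omega
  have h3 := S.eventually_tanDeriv_eq_sub hl1 (h1.of_le (by norm_cast)) h2
  have hG : ∀ j, ContDiffAt ℝ (1 : ℕ) (fun z => fderiv ℝ η' z (EuclideanSpace.single j 1)) y :=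
    fun j => ContDiffAt.fderiv_single (m := 1) h1 j
  have hGC := fun j => IsCmAt.of_contDiffAt (A := S.carrier) (hG j)
  have hn := S.isCmAt_normal_apply (m := 1) hl hy
  set H : Fin 3 → Fin 3 → ℝ := fun i j =>
    fderiv ℝ (fun z => fderiv ℝ η' z (EuclideanSpace.single j 1)) y (EuclideanSpace.single i 1)
  have hH : ∀ i j, H i j = H j i := by
    intro i j
    have hs : IsSymmSndFDerivAt ℝ η' y := h1.isSymmSndFDerivAt (by simp)
    have hd : DifferentiableAt ℝ (fderiv ℝ η') y :=
      (h1.fderiv_right (m := 1) (by norm_cast)).differentiableAt one_ne_zero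
    have he : ∀ i j, H i j =
        fderiv ℝ (fderiv ℝ η') y (EuclideanSpace.single i 1) (EuclideanSpace.single j 1) := by
      intro i j
      simp only [H]
      rw [fderiv_clm_apply hd (differentiableAt_const _)]
      simp
    rw [he, he, hs]
  set N : Fin 3 → Fin 3 → ℝ := fun i j => S.tanDeriv i (fun z => S.normal z j) y
  set g : Fin 3 → ℝ := fun k => fderiv ℝ η' y (EuclideanSpace.single k 1)
  have hDG : ∀ i j, S.tanDeriv i (fun z => fderiv ℝ η' z (EuclideanSpace.single j 1)) y =
      H i j - S.normal y i * ∑ k, S.normal y k * H k j := fun i j =>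
    S.tanDeriv_eq_sub hl1 hy (hG j) EventuallyEq.rfl
  have hD : ∀ k, S.tanDeriv k η y = g k - S.normal y k * ∑ m, S.normal y m * g m :=
    h3.self_of_nhdsWithin hy
  have hDD : ∀ i j, S.tanDeriv i (S.tanDeriv j η) y = H i j - S.normal y i *
      (∑ k, S.normal y k * H k j) - (N i j * (∑ k, S.normal y k * g k) +
      S.normal y j * ∑ k, (N i k * g k + S.normal y k *
        (H i k - S.normal y i * ∑ m, S.normal y m * H m k))) := by
    intro i j
    rw [S.tanDeriv_congr hy (h3.mono fun z hz => hz j),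
      S.tanDeriv_sub hl1 hy (hGC j)
        ((hn j).mul (IsCmAt.sum fun k _ => (hn k).mul (hGC k))),
      S.tanDeriv_mul hl1 hy (hn j) (IsCmAt.sum fun k _ => (hn k).mul (hGC k)),
      S.tanDeriv_sum hl1 hy fun k _ => (hn k).mul (hGC k), hDG]
    simp only [S.tanDeriv_mul hl1 hy (hn _) (hGC _), hDG]
    rfl
  have hNs : N i j = N j i := S.tanDeriv_normal_comm hl hy i j
  have hx := fun i => S.tanDeriv_normal_mul_normal hl hy i
  have hxi := hx i
  have hxj := hx j
  change ∑ k, N i k * S.normal y k = 0 at hxi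
  change ∑ k, N j k * S.normal y k = 0 at hxj
  -- The Hessian terms assemble to `P H P`, and the term with `N i j` is symmetric too. What
  -- survives is `n_i (N g)_j - n_j (N g)_i`, where `g` may be replaced by the tangential gradient
  -- because `N n = 0`.
  rw [hDD, hDD]
  change _ = S.normal y i * ∑ k, N j k * S.tanDeriv k η y -
      S.normal y j * ∑ k, N i k * S.tanDeriv k η y
  simp only [hD, Fin.sum_univ_three, hH i j, hH 0 i, hH 1 i, hH 2 i, hH 0 j, hH 1 j,
    hH 2 j, hH 1 0, hH 2 0, hH 2 1] at hxi hxj ⊢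
  set q := S.normal y 0 * g 0 + S.normal y 1 * g 1 + S.normal y 2 * g 2
  linear_combination (-q) * hNs + (S.normal y i * q) * hxj - (S.normal y j * q) * hxi

end General

end ClosedSurface

/-! ### The Gauss equation and the Ricci curvature in terms of the Weingarten map. -/

namespace ClosedSurface

variable {l : ℕ} (S : ClosedSurface l)

/-- The tangential derivative `D_i n_j` of the unit normal, that is, minus the Weingarten map. -/
def normalDeriv (i j : Fin 3) (y : R3) : ℝ := S.tanDeriv i (fun z => S.normal z j) y

/-- `X` is tangential and of class `C^m` near `y`. -/
def IsTangentialAt (m : ℕ) (X : R3 → R3) (y : R3) : Prop :=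
  IsCmAt m X S.carrier y ∧ ∀ᶠ z in 𝓝[S.carrier] y, ∑ k, X z k * S.normal z k = 0

variable {S} {m : ℕ} {X Y Z : R3 → R3} {y : R3} {f : R3 → ℝ}

theorem inner_eq_sum (a b : R3) : inner ℝ a b = ∑ k, a k * b k := by
  simp [PiLp.inner_apply, mul_comm]

theorem IsTangentialOn.isTangentialAt {V : Set R3} (hV : IsOpen V)
    (h : S.IsTangentialOn m X (S.carrier ∩ V)) (hy : y ∈ S.carrier) (hyV : y ∈ V) :
    S.IsTangentialAt m X y := by
  constructor
  · exact IsCmAt.mono_set (h.1 y ⟨hy, hyV⟩) (nhdsWithin_inter_isOpen hV hyV).ge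
  · filter_upwards [self_mem_nhdsWithin, mem_nhdsWithin_of_mem_nhds (hV.mem_nhds hyV)] with z h1 h2
    rw [← inner_eq_sum]
    exact h.2 z ⟨h1, h2⟩

theorem IsTangential.isTangentialAt (h : S.IsTangential m X) (hy : y ∈ S.carrier) :
    S.IsTangentialAt m X y :=
  ⟨h.1 y hy, by
    filter_upwards [self_mem_nhdsWithin] with z hz
    rw [← inner_eq_sum]
    exact h.2 z hz⟩

theorem IsTangentialAt.mono {k : ℕ} (h : S.IsTangentialAt m X y) (hk : k ≤ m) :
    S.IsTangentialAt k X y := ⟨h.1.mono hk, h.2⟩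

theorem IsTangentialAt.coord (h : S.IsTangentialAt m X y) (i : Fin 3) :
    IsCmAt m (fun z => X z i) S.carrier y := h.1.coord i

theorem IsTangentialAt.sum_eq_zero (h : S.IsTangentialAt m X y) (hy : y ∈ S.carrier) :
    ∑ k, X y k * S.normal y k = 0 := h.2.self_of_nhdsWithin hy

theorem IsTangentialAt.eventually (h : S.IsTangentialAt m X y) :
    ∀ᶠ z in 𝓝[S.carrier] y, S.IsTangentialAt m X z := by
  filter_upwards [h.1.eventually, eventually_eventually_nhdsWithin.mpr h.2] with z h1 h2
    using ⟨h1, h2⟩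

theorem isCmAt_normalDeriv (hm : m + 2 ≤ l) (hy : y ∈ S.carrier) (i j : Fin 3) :
    IsCmAt m (S.normalDeriv i j) S.carrier y :=
  S.isCmAt_tanDeriv (by omega) hy (S.isCmAt_normal_apply (by omega) hy j) i

theorem normalDeriv_comm (hl : 2 ≤ l) (hy : y ∈ S.carrier) (i j : Fin 3) :
    S.normalDeriv i j y = S.normalDeriv j i y := S.tanDeriv_normal_comm hl hy i j

theorem sum_normalDeriv_mul_normal (hl : 2 ≤ l) (hy : y ∈ S.carrier) (i : Fin 3) :
    ∑ k, S.normalDeriv i k y * S.normal y k = 0 := S.tanDeriv_normal_mul_normal hl hy i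

/-- Differentiate `X · n = 0`: the normal part of the derivative of a tangential field is of order
zero in the field. -/
theorem IsTangentialAt.sum_tanDeriv_mul_normal (hl : 2 ≤ l) (hy : y ∈ S.carrier)
    (hX : S.IsTangentialAt 1 X y) (i : Fin 3) :
    ∑ k, S.tanDeriv i (fun z => X z k) y * S.normal y k = -∑ k, S.normalDeriv i k y * X y k := by
  have h1 : S.tanDeriv i (fun z => ∑ k, X z k * S.normal z k) y = 0 := by
    rw [S.tanDeriv_congr hy (ζ := fun _ => 0) hX.2, S.tanDeriv_const (by omega) hy]
  have hn := S.isCmAt_normal_apply (m := 1) hl hy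
  rw [S.tanDeriv_sum (by omega) hy fun k _ => (hX.coord k).mul (hn k)] at h1
  simp only [S.tanDeriv_mul (by omega : 1 ≤ l) hy (hX.coord _) (hn _), Fin.sum_univ_three] at h1 ⊢
  simp only [normalDeriv]
  linarith

theorem matVec_P_apply (a : R3) (j : Fin 3) :
    matVec (S.P y) a j = a j - S.normal y j * ∑ k, S.normal y k * a k := by
  simp only [matVec, Matrix.mulVec, dotProduct, P, Matrix.of_apply, sub_mul,
    Finset.sum_sub_distrib, ite_mul, one_mul, zero_mul, Finset.sum_ite_eq, Finset.mem_univ, if_true,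
    Finset.mul_sum, mul_assoc]

theorem covDerivAt_apply (X : R3 → R3) (y a : R3) (j : Fin 3) :
    S.covDerivAt X y a j = (∑ i, a i * S.tanDeriv i (fun z => X z j) y) -
      S.normal y j * ∑ k, S.normal y k * ∑ i, a i * S.tanDeriv i (fun z => X z k) y := by
  rw [covDerivAt, matVec_P_apply]
  simp only [matVec, Matrix.mulVec, dotProduct, Matrix.transpose_apply, gradMat, Matrix.of_apply,
    mul_comm]

theorem IsTangentialAt.covDerivAt_apply (hl : 2 ≤ l) (hy : y ∈ S.carrier)
    (hX : S.IsTangentialAt 1 X y) (a : R3) (j : Fin 3) :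
    S.covDerivAt X y a j = (∑ i, a i * S.tanDeriv i (fun z => X z j) y) +
      S.normal y j * ∑ i, ∑ k, a i * S.normalDeriv i k y * X y k := by
  rw [ClosedSurface.covDerivAt_apply]
  have h := hX.sum_tanDeriv_mul_normal hl hy
  have h0 := h 0
  have h1 := h 1
  have h2 := h 2
  simp only [Fin.sum_univ_three] at h0 h1 h2 ⊢
  linear_combination (-S.normal y j * a 0) * h0 + (-S.normal y j * a 1) * h1 +
    (-S.normal y j * a 2) * h2

/-- The commutator of the derivatives along two tangential fields. -/
theorem sum_mul_tanDeriv_sum_sub (hl : 3 ≤ l) (hy : y ∈ S.carrier)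
    (hX : S.IsTangentialAt 1 X y) (hY : S.IsTangentialAt 1 Y y) (hf : IsCmAt 2 f S.carrier y) :
    (∑ a, X y a * S.tanDeriv a (fun z => ∑ i, Y z i * S.tanDeriv i f z) y) -
      (∑ a, Y y a * S.tanDeriv a (fun z => ∑ i, X z i * S.tanDeriv i f z) y) =
    ∑ i, ((∑ a, X y a * S.tanDeriv a (fun z => Y z i) y) -
      ∑ a, Y y a * S.tanDeriv a (fun z => X z i) y) * S.tanDeriv i f y := by
  have hl1 : 1 ≤ l := by omega
  have hD : ∀ i, IsCmAt 1 (S.tanDeriv i f) S.carrier y := S.isCmAt_tanDeriv (by omega) hy hf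
  have e : ∀ {V : R3 → R3}, S.IsTangentialAt 1 V y → ∀ a,
      S.tanDeriv a (fun z => ∑ i, V z i * S.tanDeriv i f z) y =
      ∑ i, (S.tanDeriv a (fun z => V z i) y * S.tanDeriv i f y +
        V y i * S.tanDeriv a (S.tanDeriv i f) y) := by
    intro V hV a
    rw [S.tanDeriv_sum hl1 hy fun i _ => (hV.coord i).mul (hD i)]
    exact Finset.sum_congr rfl fun i _ => S.tanDeriv_mul hl1 hy (hV.coord i) (hD i)
  simp only [e hX, e hY]
  have hc := fun i j => S.tanDeriv_tanDeriv_sub (by omega) hy hf i j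
  have hX0 := hX.sum_eq_zero hy
  have hY0 := hY.sum_eq_zero hy
  set B : Fin 3 → ℝ := fun i => ∑ k, S.tanDeriv i (fun z => S.normal z k) y * S.tanDeriv k f y
  have hc' : ∀ i j, S.tanDeriv i (S.tanDeriv j f) y = S.tanDeriv j (S.tanDeriv i f) y +
      S.normal y i * B j - S.normal y j * B i := fun i j => by
    simp only [B]
    linarith [hc i j]
  simp only [Fin.sum_univ_three] at hX0 hY0 ⊢
  rw [hc' 0 1, hc' 0 2, hc' 1 2]
  -- Each commutator term carries a factor `n_i`, which is contracted with `X` or `Y` and vanishes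
  -- by tangency.
  linear_combination (B 0 * Y y 0 + B 1 * Y y 1 + B 2 * Y y 2) * hX0 -
    (B 0 * X y 0 + B 1 * X y 1 + B 2 * X y 2) * hY0

/-- Near `y` the inner field is the flat derivative of `Z` along `Y` plus `Q n`, with `Q` the
bilinear form of `N` on `Y` and `Z`. Differentiating `Q n` along `X` and projecting removes the
derivative of `Q` and leaves `Q` times `N X`. The flat second derivatives stay under `P`, ready to
cancel against the bracket term of the curvature. -/
theorem covDeriv_covDeriv_apply (hl : 3 ≤ l) (hy : y ∈ S.carrier)
    (hY : S.IsTangentialAt 1 Y y) (hZ : S.IsTangentialAt 2 Z y) (j : Fin 3) :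
    S.covDeriv X (S.covDeriv Y Z) y j =
      (∑ m, S.P y j m * ∑ a, X y a *
        S.tanDeriv a (fun z => ∑ i, Y z i * S.tanDeriv i (fun z => Z z m) z) y) +
      (∑ i, ∑ k, Y y i * S.normalDeriv i k y * Z y k) *
        ∑ a, X y a * S.normalDeriv a j y := by
  have hl1 : 1 ≤ l := by omega
  have hn := S.isCmAt_normal_apply (m := 1) (by omega) hy
  have hD : ∀ m i, IsCmAt 1 (S.tanDeriv i fun z => Z z m) S.carrier y := fun m =>
    S.isCmAt_tanDeriv (by omega) hy (hZ.coord m)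
  have hT : ∀ m, IsCmAt 1 (fun z => ∑ i, Y z i * S.tanDeriv i (fun z => Z z m) z) S.carrier y :=
    fun m => IsCmAt.sum fun i _ => (hY.coord i).mul (hD m i)
  set Q : R3 → ℝ := fun z => ∑ i, ∑ k, Y z i * S.normalDeriv i k z * Z z k with hQdef
  have hQ : IsCmAt 1 Q S.carrier y := IsCmAt.sum fun i _ => IsCmAt.sum fun k _ =>
    ((hY.coord i).mul (isCmAt_normalDeriv (by omega) hy i k)).mul ((hZ.mono one_le_two).coord k)
  have he : ∀ m, (fun z => S.covDeriv Y Z z m) =ᶠ[𝓝[S.carrier] y] fun z =>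
      (∑ i, Y z i * S.tanDeriv i (fun z => Z z m) z) + S.normal z m * Q z := by
    intro m
    filter_upwards [hZ.eventually, self_mem_nhdsWithin] with z hz hzΓ
    exact (hz.mono one_le_two).covDerivAt_apply (by omega) hzΓ (Y z) m
  have hd : ∀ a m, S.tanDeriv a (fun z => S.covDeriv Y Z z m) y =
      S.tanDeriv a (fun z => ∑ i, Y z i * S.tanDeriv i (fun z => Z z m) z) y +
      (S.normalDeriv a m y * Q y + S.normal y m * S.tanDeriv a Q y) := by
    intro a m
    rw [S.tanDeriv_congr hy (he m), S.tanDeriv_add hl1 hy (hT m) ((hn m).mul hQ),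
      S.tanDeriv_mul hl1 hy (hn m) hQ]
    rfl
  have h1 := S.sum_normal_mul_self hy
  have h2 := fun i => sum_normalDeriv_mul_normal (S := S) (by omega) hy i
  have h20 := h2 0
  have h21 := h2 1
  have h22 := h2 2
  change S.covDerivAt (S.covDeriv Y Z) y (X y) j = _
  rw [ClosedSurface.covDerivAt_apply]
  simp only [hd]
  have hP : ∀ v : Fin 3 → ℝ, ∑ m, S.P y j m * v m = v j - S.normal y j * ∑ k, S.normal y k * v k :=
    fun v => matVec_P_apply (S := S) (y := y) (WithLp.toLp 2 v) j
  rw [hP]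
  change _ = _ + Q y * _
  simp only [Fin.sum_univ_three] at h1 h20 h21 h22 ⊢
  linear_combination (-S.normal y j * Q y) * (X y 0 * h20 + X y 1 * h21 + X y 2 * h22) -
    S.normal y j * (X y 0 * S.tanDeriv 0 Q y + X y 1 * S.tanDeriv 1 Q y +
      X y 2 * S.tanDeriv 2 Q y) * h1

/-- The Gauss equation. -/
theorem curv_apply (hl : 3 ≤ l) (hy : y ∈ S.carrier) (hX : S.IsTangentialAt 2 X y)
    (hY : S.IsTangentialAt 2 Y y) (hZ : S.IsTangentialAt 2 Z y) (j : Fin 3) :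
    S.curv X Y Z y j =
      (∑ i, ∑ k, Y y i * S.normalDeriv i k y * Z y k) * (∑ a, X y a * S.normalDeriv a j y) -
      (∑ i, ∑ k, X y i * S.normalDeriv i k y * Z y k) * ∑ a, Y y a * S.normalDeriv a j y := by
  have hX1 := hX.mono one_le_two
  have hY1 := hY.mono one_le_two
  have hc := fun m => sum_mul_tanDeriv_sum_sub hl hy hX1 hY1 (hZ.coord m)
  -- The normal corrections cancel by symmetry of `N`, so the connection has no torsion and the
  -- bracket is the flat one.
  have hbr : ∀ i, S.covDeriv X Y y i - S.covDeriv Y X y i =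
      (∑ a, X y a * S.tanDeriv a (fun z => Y z i) y) -
      ∑ a, Y y a * S.tanDeriv a (fun z => X z i) y := by
    intro i
    have h1 : S.covDeriv X Y y i = _ := hY1.covDerivAt_apply (by omega) hy (X y) i
    have h2 : S.covDeriv Y X y i = _ := hX1.covDerivAt_apply (by omega) hy (Y y) i
    rw [h1, h2]
    simp only [Fin.sum_univ_three, normalDeriv_comm (S := S) (by omega) hy 1 0,
      normalDeriv_comm (S := S) (by omega) hy 2 0, normalDeriv_comm (S := S) (by omega) hy 2 1]
    ring
  have hlast : S.covDeriv (fun z => S.covDeriv X Y z - S.covDeriv Y X z) Z y j =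
      ∑ m, S.P y j m * ∑ i, (S.covDeriv X Y y i - S.covDeriv Y X y i) *
        S.tanDeriv i (fun z => Z z m) y := by
    change S.covDerivAt Z y (S.covDeriv X Y y - S.covDeriv Y X y) j = _
    rw [ClosedSurface.covDerivAt_apply]
    exact (matVec_P_apply (S := S) (y := y) (WithLp.toLp 2 fun m =>
      ∑ i, (S.covDeriv X Y y i - S.covDeriv Y X y i) * S.tanDeriv i (fun z => Z z m) y) j).symm
  rw [curv]
  simp only [PiLp.sub_apply]
  rw [covDeriv_covDeriv_apply hl hy hY1 hZ, covDeriv_covDeriv_apply hl hy hX1 hZ, hlast]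
  -- By `hc` the bracket term equals the difference of the projected flat second derivatives; only
  -- the products of `N` remain.
  simp only [hbr, ← hc, mul_sub, Finset.sum_sub_distrib]
  ring

/-- An orthonormal frame of the tangent plane resolves the tangential projection. -/
theorem sum_frame_mul {τ : Fin 2 → R3} (hy : y ∈ S.carrier) (hτ : Orthonormal ℝ τ)
    (hn : ∀ i, ∑ k, τ i k * S.normal y k = 0) (a b : Fin 3) :
    ∑ i, τ i a * τ i b = S.P y a b := by
  -- The rows of `M` form an orthonormal basis of `ℝ³`; the claim is the orthonormality of its
  -- columns with the normal term moved to the other side.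
  let M : Matrix (Fin 3) (Fin 3) ℝ := Matrix.of ![fun k => τ 0 k, fun k => τ 1 k,
    fun k => S.normal y k]
  have ho : ∀ i j, ∑ k, τ i k * τ j k = if i = j then 1 else 0 := by
    intro i j
    rw [← inner_eq_sum, orthonormal_iff_ite.mp hτ]
  have hM : M * M.transpose = 1 := by
    have h00 := ho 0 0
    have h01 := ho 0 1
    have h11 := ho 1 1
    have hn0 := hn 0
    have hn1 := hn 1
    have h1 := S.sum_normal_mul_self hy
    simp only [Fin.sum_univ_three] at h00 h01 h11 hn0 hn1 h1
    simp at h00 h01 h11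
    ext i j
    fin_cases i <;> fin_cases j <;> simp [M, Matrix.mul_apply, Fin.sum_univ_three] <;> linarith
  have hMt : M.transpose * M = 1 := mul_eq_one_comm.mp hM
  have hM' := congrFun (congrFun hMt a) b
  simp [M, Matrix.mul_apply, Fin.sum_univ_three, Matrix.one_apply] at hM'
  simp only [P, Matrix.of_apply, Fin.sum_univ_two]
  linarith

/-- The sum defining the Ricci curvature, in terms of the derivative of the unit normal. -/
theorem sum_curv_apply (hl : 3 ≤ l) (hX : S.IsTangentialAt 2 X y) {V : Set R3}
    {τ : Fin 2 → R3 → R3} (hτ : S.IsFrame V τ) (hy : y ∈ S.carrier ∩ V) (j : Fin 3) :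
    (∑ i, S.curv X (τ i) (τ i) y) j =
      (∑ i, S.normalDeriv i i y) * (∑ a, X y a * S.normalDeriv a j y) -
      ∑ b, (∑ a, X y a * S.normalDeriv a b y) * S.normalDeriv b j y := by
  have ht : ∀ i, S.IsTangentialAt 2 (τ i) y := fun i =>
    (hτ.tangential i).isTangentialAt hτ.isOpen hy.1 hy.2
  have hs := sum_frame_mul hy.1 (hτ.orthonormal y hy) fun i => (ht i).sum_eq_zero hy.1
  have h : (∑ i, S.curv X (τ i) (τ i) y) j = ∑ i, S.curv X (τ i) (τ i) y j := by simp
  rw [h]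
  simp only [curv_apply hl hy.1 hX (ht _) (ht _)]
  have hN' : ∀ i, ∑ k, S.normal y k * S.normalDeriv k i y = 0 := fun i =>
    S.sum_normal_mul_tanDeriv hy.1 _
  set N := fun i j => S.normalDeriv i j y
  -- Contraction over the frame is contraction with `P`. Its normal part is annihilated by `n N =
  -- 0`, so the sums over the tangent plane become full sums over `Fin 3`.
  have e1 : ∑ i, ∑ a, ∑ k, τ i y a * N a k * τ i y k = ∑ i, N i i := by
    calc ∑ i, ∑ a, ∑ k, τ i y a * N a k * τ i y k
        = ∑ a, ∑ k, N a k * ∑ i, τ i y a * τ i y k := by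
          simp only [Fin.sum_univ_two, Fin.sum_univ_three]; ring
      _ = ∑ i, N i i - ∑ k, (∑ a, S.normal y a * N a k) * S.normal y k := by
          simp only [hs, P, Matrix.of_apply, Fin.sum_univ_three]
          simp
          ring
      _ = ∑ i, N i i := by
          have h0 : ∑ k, (∑ a, S.normal y a * N a k) * S.normal y k = 0 :=
            Finset.sum_eq_zero fun k _ => by rw [hN' k, zero_mul]
          rw [h0, sub_zero]
  have e2 : ∑ i, (∑ a, ∑ k, X y a * N a k * τ i y k) * ∑ b, τ i y b * N b j =
      ∑ b, (∑ a, X y a * N a b) * N b j := by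
    calc ∑ i, (∑ a, ∑ k, X y a * N a k * τ i y k) * ∑ b, τ i y b * N b j
        = ∑ k, ∑ b, (∑ a, X y a * N a k) * N b j * ∑ i, τ i y k * τ i y b := by
          simp only [Fin.sum_univ_two, Fin.sum_univ_three]; ring
      _ = ∑ b, (∑ a, X y a * N a b) * N b j - (∑ k, (∑ a, X y a * N a k) * S.normal y k) *
            ∑ b, S.normal y b * N b j := by
          simp only [hs, P, Matrix.of_apply, Fin.sum_univ_three]
          simp
          ring
      _ = ∑ b, (∑ a, X y a * N a b) * N b j := by rw [hN' j, mul_zero, sub_zero]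
  rw [Finset.sum_sub_distrib, ← Finset.sum_mul, e1, e2]

end ClosedSurface

/-! ### The divergence of the strain tensor. -/

namespace ClosedSurface

variable {l : ℕ} {S : ClosedSurface l}  {X Y Z : R3 → R3} {y : R3} {f : R3 → ℝ}

variable (S) in
/-- The tangential part `(∇_Γ X) P` of the gradient matrix of `X`. -/
def covMat (X : R3 → R3) (z : R3) : Matrix (Fin 3) (Fin 3) ℝ := S.gradMat X z * S.P z

theorem covMat_apply (X : R3 → R3) (z : R3) (i j : Fin 3) :
    S.covMat X z i j = S.tanDeriv i (fun z => X z j) z -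
      (∑ k, S.tanDeriv i (fun z => X z k) z * S.normal z k) * S.normal z j := by
  simp only [covMat, Matrix.mul_apply, gradMat, Matrix.of_apply, P, mul_sub, mul_ite, mul_one,
    mul_zero, Finset.sum_sub_distrib, Finset.sum_ite_eq', Finset.mem_univ, if_true,
    Finset.sum_mul, mul_assoc]

theorem IsTangentialAt.covMat_apply (hl : 2 ≤ l) (hy : y ∈ S.carrier)
    (hX : S.IsTangentialAt 1 X y) (i j : Fin 3) :
    S.covMat X y i j = S.tanDeriv i (fun z => X z j) y +
      (∑ k, S.normalDeriv i k y * X y k) * S.normal y j := by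
  rw [ClosedSurface.covMat_apply, hX.sum_tanDeriv_mul_normal hl hy]
  ring

theorem isCmAt_covMat (hl : 3 ≤ l) (hy : y ∈ S.carrier) (hX : IsCmAt 2 X S.carrier y)
    (i j : Fin 3) : IsCmAt 1 (fun z => S.covMat X z i j) S.carrier y := by
  have hn := S.isCmAt_normal_apply (m := 1) (by omega) hy
  have hD : ∀ k, IsCmAt 1 (S.tanDeriv i fun z => X z k) S.carrier y := fun k =>
    S.isCmAt_tanDeriv (by omega) hy (hX.coord k) i
  simp only [ClosedSurface.covMat_apply]
  exact (hD j).sub ((IsCmAt.sum fun k _ => (hD k).mul (hn k)).mul (hn j))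

theorem sum_normal_mul_covMat (hy : y ∈ S.carrier) (X : R3 → R3) (j : Fin 3) :
    ∑ i, S.normal y i * S.covMat X y i j = 0 := by
  have h := fun j => S.sum_normal_mul_tanDeriv hy fun z => X z j
  have hj := h j
  have h0 := h 0
  have h1 := h 1
  have h2 := h 2
  simp only [ClosedSurface.covMat_apply, Fin.sum_univ_three] at h0 h1 h2 hj ⊢
  linear_combination hj - (S.normal y j * S.normal y 0) * h0 - (S.normal y j * S.normal y 1) * h1
    - (S.normal y j * S.normal y 2) * h2

theorem sum_covMat_mul_normal (hy : y ∈ S.carrier) (X : R3 → R3) (i : Fin 3) :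
    ∑ j, S.covMat X y i j * S.normal y j = 0 := by
  have h1 := S.sum_normal_mul_self hy
  simp only [ClosedSurface.covMat_apply, Fin.sum_univ_three] at h1 ⊢
  set s := S.tanDeriv i (fun z => X z 0) y * S.normal y 0 +
    S.tanDeriv i (fun z => X z 1) y * S.normal y 1 + S.tanDeriv i (fun z => X z 2) y * S.normal y 2
  linear_combination (-s) * h1

/-- The columns of `∇_Γ X` are tangential gradients, so `P ∇_Γ X = ∇_Γ X` and the left projection in
`P (∇_Γ X) P` is superfluous. -/
theorem strain_apply (hy : y ∈ S.carrier) (X : R3 → R3) (i j : Fin 3) :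
    S.strain X y i j = 1 / 2 * (S.covMat X y i j + S.covMat X y j i) := by
  have hPG : S.P y * S.gradMat X y = S.gradMat X y := by
    ext i j
    have h := S.sum_normal_mul_tanDeriv hy fun z => X z j
    simp only [Matrix.mul_apply, P, gradMat, Matrix.of_apply, sub_mul, ite_mul, one_mul, zero_mul,
      Finset.sum_sub_distrib, Finset.sum_ite_eq, Finset.mem_univ, if_true, mul_assoc,
      ← Finset.mul_sum, h, mul_zero, sub_zero]
  have hPt : (S.P y).transpose = S.P y := by
    ext i j
    simp [P, mul_comm, eq_comm]
  have h : S.strain X y = (1 / 2 : ℝ) • (S.covMat X y + (S.covMat X y).transpose) := by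
    have hGP : (S.gradMat X y).transpose * S.P y = (S.gradMat X y).transpose := by
      conv_lhs => rw [← hPt, ← Matrix.transpose_mul, hPG]
    rw [strain, covMat, Matrix.transpose_mul, hPt]
    simp only [Matrix.mul_smul, Matrix.smul_mul, mul_add, add_mul, hPG, Matrix.mul_assoc, hGP]
  rw [h]
  simp

/-- The transposed covariant derivative has divergence `∇_Γ div_Γ X + Ric(X)` up to normal parts. -/
theorem matVec_P_divMat_covMat_transpose (hl : 3 ≤ l) (hy : y ∈ S.carrier)
    (hX : S.IsTangentialAt 2 X y) (j : Fin 3) :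
    matVec (S.P y) (S.divMat (fun z => (S.covMat X z).transpose) y) j =
      S.grad (S.div X) y j +
      ((∑ i, S.normalDeriv i i y) * (∑ a, X y a * S.normalDeriv a j y) -
      ∑ b, (∑ a, X y a * S.normalDeriv a b y) * S.normalDeriv b j y) := by
  have hl1 : 1 ≤ l := by omega
  have hn := S.isCmAt_normal_apply (m := 1) (by omega) hy
  have hX1 := hX.mono one_le_two
  have hD : ∀ j k, IsCmAt 1 (S.tanDeriv j fun z => X z k) S.carrier y := fun j k =>
    S.isCmAt_tanDeriv (by omega) hy (hX.coord k) j
  set M : Fin 3 → R3 → ℝ := fun i z => ∑ k, S.normalDeriv i k z * X z k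
  have hM : ∀ i, IsCmAt 1 (M i) S.carrier y := fun i => IsCmAt.sum fun k _ =>
    (isCmAt_normalDeriv (by omega) hy i k).mul (hX1.coord k)
  have hA : ∀ i j, S.tanDeriv i (fun z => (S.covMat X z).transpose i j) y =
      S.tanDeriv i (S.tanDeriv j fun z => X z i) y +
      (S.tanDeriv i (M j) y * S.normal y i + M j y * S.normalDeriv i i y) := by
    intro i j
    rw [S.tanDeriv_congr hy (ζ := fun z => S.tanDeriv j (fun z => X z i) z + M j z * S.normal z i),
      S.tanDeriv_add hl1 hy (hD j i) ((hM j).mul (hn i)), S.tanDeriv_mul hl1 hy (hM j) (hn i)]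
    · rfl
    · filter_upwards [hX1.eventually, self_mem_nhdsWithin] with z hz hzΓ
      exact hz.covMat_apply (by omega) hzΓ j i
  have hdiv : ∀ j, S.tanDeriv j (S.div X) y = ∑ i, S.tanDeriv j (S.tanDeriv i fun z => X z i) y :=
    fun j => S.tanDeriv_sum (s := Finset.univ) (η := fun i => S.tanDeriv i fun z => X z i) hl1 hy
      fun i _ => hD i i
  have hdn := S.sum_normal_mul_tanDeriv hy (S.div X)
  have hMn := fun j => S.sum_normal_mul_tanDeriv hy (M j)
  have hXn := hX1.sum_tanDeriv_mul_normal (by omega) hy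
  have hc : ∀ i j, S.tanDeriv i (S.tanDeriv j fun z => X z i) y =
      S.tanDeriv j (S.tanDeriv i fun z => X z i) y +
      (S.normal y i * ∑ k, S.normalDeriv j k y * S.tanDeriv k (fun z => X z i) y -
      S.normal y j * ∑ k, S.normalDeriv i k y * S.tanDeriv k (fun z => X z i) y) := fun i j => by
    have := S.tanDeriv_tanDeriv_sub (by omega) hy (hX.coord i) i j
    simp only [normalDeriv]
    linarith
  set N : Fin 3 → Fin 3 → ℝ := fun i j => S.normalDeriv i j y with hNdef
  have hNs : ∀ i j, N i j = N j i := fun i j => normalDeriv_comm (by omega) hy i j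
  have hNn : ∀ i, ∑ k, S.normal y k * N k i = 0 := fun i => S.sum_normal_mul_tanDeriv hy _
  set DX : Fin 3 → Fin 3 → ℝ := fun i j => S.tanDeriv i (fun z => X z j) y
  set R : ℝ := ∑ i, ∑ k, N i k * DX k i
  have hXn' : ∀ i, ∑ k, DX i k * S.normal y k = -M i y := hXn
  -- In `D_i (M_j n_i)` only the trace of `N` survives, as `n · ∇_Γ M_j = 0`. The commutator
  -- contributes `- N M`, through `hXn'`, and a multiple of `n_j` that the projection removes
  -- afterwards.
  have hE : ∀ j, ∑ i, S.tanDeriv i (fun z => (S.covMat X z).transpose i j) y =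
      S.tanDeriv j (S.div X) y - ∑ k, N j k * M k y + M j y * (∑ i, N i i) - S.normal y j * R := by
    intro j
    have h0 := hXn' 0
    have h1 := hXn' 1
    have h2 := hXn' 2
    have h3 := hMn j
    simp only [hA, hc, hdiv, R]
    change ∑ i, (_ + (_ * (∑ k, N j k * DX k i) - _ * ∑ k, N i k * DX k i) +
      (_ + _ * N i i)) = _
    simp only [Fin.sum_univ_three] at h0 h1 h2 h3 ⊢
    linear_combination N j 0 * h0 + N j 1 * h1 + N j 2 * h2 + h3
  have hMN : ∀ j, ∑ a, X y a * N a j = M j y := fun j =>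
    Finset.sum_congr rfl fun a _ => by rw [hNs a j, mul_comm]
  have hMn' : ∑ k, S.normal y k * M k y = 0 := by
    have h0 := hNn 0
    have h1 := hNn 1
    have h2 := hNn 2
    simp only [Fin.sum_univ_three, M] at h0 h1 h2 ⊢
    change _ * (N 0 0 * _ + N 0 1 * _ + N 0 2 * _) + _ * (N 1 0 * _ + N 1 1 * _ + N 1 2 * _) +
      _ * (N 2 0 * _ + N 2 1 * _ + N 2 2 * _) = 0
    linear_combination X y 0 * h0 + X y 1 * h1 + X y 2 * h2
  rw [matVec_P_apply]
  change (∑ i, S.tanDeriv i (fun z => (S.covMat X z).transpose i j) y) - S.normal y j *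
    ∑ k, S.normal y k * (∑ i, S.tanDeriv i (fun z => (S.covMat X z).transpose i k) y) =
    S.tanDeriv j (S.div X) y + ((∑ i, N i i) * (∑ a, X y a * N a j) -
      ∑ b, (∑ a, X y a * N a b) * N b j)
  have h1 := S.sum_normal_mul_self hy
  have h20 := hNn 0
  have h21 := hNn 1
  have h22 := hNn 2
  simp only [hMN, hE]
  have hT : ∑ b, M b y * N b j = ∑ k, N j k * M k y :=
    Finset.sum_congr rfl fun b _ => by rw [hNs b j, mul_comm]
  rw [hT]
  simp only [Fin.sum_univ_three] at h1 h20 h21 h22 hMn' hdn ⊢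
  linear_combination (S.normal y j * R) * h1 - S.normal y j * hdn -
    (S.normal y j * (N 0 0 + N 1 1 + N 2 2)) * hMn' +
    (S.normal y j * M 0 y) * h20 + (S.normal y j * M 1 y) * h21 + (S.normal y j * M 2 y) * h22

theorem two_smul_matVec_divMat_strain (hl : 3 ≤ l) (hy : y ∈ S.carrier)
    (hX : S.IsTangentialAt 2 X y) (j : Fin 3) :
    ((2 : ℝ) • matVec (S.P y) (S.divMat (S.strain X) y)) j =
      matVec (S.P y) (S.divMat (S.covMat X) y) j + S.grad (S.div X) y j +
      ((∑ i, S.normalDeriv i i y) * (∑ a, X y a * S.normalDeriv a j y) -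
      ∑ b, (∑ a, X y a * S.normalDeriv a b y) * S.normalDeriv b j y) := by
  have hl1 : 1 ≤ l := by omega
  have hA := isCmAt_covMat hl hy hX.1
  rw [add_assoc, ← matVec_P_divMat_covMat_transpose hl hy hX]
  have h : ∀ k, S.divMat (S.strain X) y k =
      1 / 2 * (S.divMat (S.covMat X) y k + S.divMat (fun z => (S.covMat X z).transpose) y k) := by
    intro k
    simp only [divMat, Matrix.transpose_apply]
    rw [← Finset.sum_add_distrib, Finset.mul_sum]
    refine Finset.sum_congr rfl fun i _ => ?_
    rw [S.tanDeriv_congr hy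
      (ζ := fun z => 1 / 2 * (S.covMat X z i k + S.covMat X z k i)),
      S.tanDeriv_mul hl1 hy (IsCmAt.const (1 / 2 : ℝ)) ((hA i k).add (hA k i)),
      S.tanDeriv_const hl1 hy, S.tanDeriv_add hl1 hy (hA i k) (hA k i)]
    · simp
    · filter_upwards [self_mem_nhdsWithin] with z hz
      exact strain_apply hz X i k
  rw [PiLp.smul_apply, smul_eq_mul, matVec_P_apply, matVec_P_apply, matVec_P_apply]
  simp only [h, Fin.sum_univ_three]
  ring

/-! ### Local orthonormal frames and the value of the Ricci curvature. -/

/-- A `C²` orthonormal frame exists around every point. -/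
theorem exists_isFrame (hl : 3 ≤ l) (hy : y ∈ S.carrier) : ∃ V τ, S.IsFrame V τ ∧ y ∈ V := by
  -- The three squares add up to one, so some coordinate vector is not parallel to the normal.
  obtain ⟨i, hi⟩ : ∃ i, S.normal y i ^ 2 < 1 := by
    by_contra! h
    have h1 := S.sum_normal_mul_self hy
    simp only [Fin.sum_univ_three] at h1
    nlinarith [h 0, h 1, h 2]
  have hnc : ContinuousWithinAt (fun z => S.normal z i ^ 2) S.carrier y :=
    ((S.isCmAt_normal_apply (m := 0) (by omega) hy i).continuousWithinAt hy).pow 2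
  obtain ⟨V, hV, hyV, hVΓ⟩ := mem_nhdsWithin.mp (hnc.eventually (gt_mem_nhds hi))
  let r : R3 → ℝ := fun z => (√(1 - S.normal z i ^ 2))⁻¹
  -- The first vector is the normalized tangential projection of `e_i`, whose length is `√(1 -
  -- n_i²)`; the second is `n × τ₀`, with indices taken modulo three.
  let τ₀ : Fin 3 → R3 → ℝ := fun k z =>
    r z * ((if k = i then 1 else 0) - S.normal z i * S.normal z k)
  let τ₁ : Fin 3 → R3 → ℝ := fun k z =>
    S.normal z (k + 1) * τ₀ (k + 2) z - S.normal z (k + 2) * τ₀ (k + 1) z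
  have hr : ∀ z ∈ S.carrier ∩ V, IsCmAt 2 r S.carrier z := by
    intro z hz
    have hpos : 0 < 1 - S.normal z i ^ 2 := by
      have : S.normal z i ^ 2 < 1 := hVΓ ⟨hz.2, hz.1⟩
      linarith
    refine (S.isCmAt_normal_apply (m := 2) hl hz.1 i).comp (Ψ := fun t => (√(1 - t ^ 2))⁻¹) hz.1 ?_
    refine ContDiffAt.inv ?_ (Real.sqrt_pos.mpr hpos).ne'
    exact ContDiffAt.sqrt (by fun_prop) hpos.ne'
  have hn : ∀ z ∈ S.carrier ∩ V, ∀ k, IsCmAt 2 (fun z => S.normal z k) S.carrier z :=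
    fun z hz => S.isCmAt_normal_apply hl hz.1
  have h0 : ∀ z ∈ S.carrier ∩ V, ∀ k, IsCmAt 2 (τ₀ k) S.carrier z := fun z hz k =>
    (hr z hz).mul ((IsCmAt.const _).sub ((hn z hz i).mul (hn z hz k)))
  have h1 : ∀ z ∈ S.carrier ∩ V, ∀ k, IsCmAt 2 (τ₁ k) S.carrier z := fun z hz k =>
    ((hn z hz _).mul (h0 z hz _)).sub ((hn z hz _).mul (h0 z hz _))
  have hr2 : ∀ z ∈ S.carrier ∩ V, r z ^ 2 * (1 - S.normal z i ^ 2) = 1 := by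
    intro z hz
    have hpos : 0 < 1 - S.normal z i ^ 2 := by
      have : S.normal z i ^ 2 < 1 := hVΓ ⟨hz.2, hz.1⟩
      linarith
    simp only [r, inv_pow, Real.sq_sqrt hpos.le]
    exact inv_mul_cancel₀ hpos.ne'
  have e00 : ∀ z ∈ S.carrier ∩ V, ∑ k, τ₀ k z * τ₀ k z = 1 := by
    intro z hz
    have h := S.sum_normal_mul_self hz.1
    have h' := hr2 z hz
    simp only [Fin.sum_univ_three, τ₀] at h ⊢
    fin_cases i <;> simp at h' ⊢ <;> linear_combination h' + r z ^ 2 * (S.normal z _) ^ 2 * h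
  have e0n : ∀ z ∈ S.carrier ∩ V, ∑ k, τ₀ k z * S.normal z k = 0 := by
    intro z hz
    have h := S.sum_normal_mul_self hz.1
    simp only [Fin.sum_univ_three, τ₀] at h ⊢
    fin_cases i <;> simp <;> linear_combination (-r z * S.normal z _) * h
  have e1n : ∀ z, ∑ k, τ₁ k z * S.normal z k = 0 := by
    intro z
    simp [Fin.sum_univ_three, τ₁]
    ring
  have e01 : ∀ z, ∑ k, τ₀ k z * τ₁ k z = 0 := by
    intro z
    simp [Fin.sum_univ_three, τ₁]
    ring
  have e11 : ∀ z ∈ S.carrier ∩ V, ∑ k, τ₁ k z * τ₁ k z = 1 := by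
    intro z hz
    have h := S.sum_normal_mul_self hz.1
    have h' := e00 z hz
    have h'' := e0n z hz
    -- Lagrange's identity for the cross product.
    have e : ∑ k, τ₁ k z * τ₁ k z = (∑ k, S.normal z k * S.normal z k) * (∑ k, τ₀ k z * τ₀ k z)
        - (∑ k, τ₀ k z * S.normal z k) ^ 2 := by
      simp [Fin.sum_univ_three, τ₁]
      ring
    rw [e, h, h', h'']
    norm_num
  have hof : ∀ {u : Fin 3 → R3 → ℝ}, (∀ z ∈ S.carrier ∩ V, ∀ k, IsCmAt 2 (u k) S.carrier z) →
      (∀ z ∈ S.carrier ∩ V, ∑ k, u k z * S.normal z k = 0) →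
      S.IsTangentialOn 2 (fun z => WithLp.toLp 2 fun k => u k z) (S.carrier ∩ V) := by
    intro u hu hun
    refine ⟨fun z hz => ?_, fun z hz => ?_⟩
    · have : IsCmAt 2 (fun z => (WithLp.toLp 2 fun k => u k z : R3)) S.carrier z :=
        IsCmAt.of_coord (hu z hz)
      exact this.mono_set (nhdsWithin_mono z Set.inter_subset_left)
    · rw [inner_eq_sum]
      exact hun z hz
  refine ⟨V, ![fun z => WithLp.toLp 2 fun k => τ₀ k z, fun z => WithLp.toLp 2 fun k => τ₁ k z],
    ⟨hV, ?_, ?_⟩, hyV⟩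
  · intro j
    fin_cases j
    · exact hof h0 e0n
    · exact hof h1 fun z _ => e1n z
  · intro z hz
    rw [orthonormal_iff_ite]
    intro a b
    rw [inner_eq_sum]
    fin_cases a <;> fin_cases b
    · simpa using e00 z hz
    · simpa using e01 z
    · simpa [mul_comm] using e01 z
    · simpa using e11 z hz

/-- The right-hand side contains no frame, which is why the choice made in `ricci` is immaterial. -/
theorem ricci_apply (hl : 3 ≤ l) (hy : y ∈ S.carrier) (hX : S.IsTangentialAt 2 X y) (j : Fin 3) :
    S.ricci X y j = (∑ i, S.normalDeriv i i y) * (∑ a, X y a * S.normalDeriv a j y) -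
      ∑ b, (∑ a, X y a * S.normalDeriv a b y) * S.normalDeriv b j y := by
  have h : ∃ Vτ : Set R3 × (Fin 2 → R3 → R3), S.IsFrame Vτ.1 Vτ.2 ∧ y ∈ Vτ.1 := by
    obtain ⟨V, τ, h⟩ := exists_isFrame hl hy
    exact ⟨(V, τ), h⟩
  rw [ricci, dif_pos h]
  exact sum_curv_apply hl hX h.choose_spec.1 ⟨hy, h.choose_spec.2⟩ j

end ClosedSurface

/-! ### Local parametrizations and the chain rule. -/

theorem finrank_R2 : Module.finrank ℝ R2 = 2 := by simp

namespace IsLocalParam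

variable {l : ℕ} {Γ : Set R3} {U B : Set R2} {μ : R2 → R3}

theorem injOn (h : IsLocalParam l Γ U μ) : Set.InjOn μ U := by
  obtain ⟨σ, -, hσ⟩ := h.exists_continuous_inverse
  intro s hs t ht hst
  rw [← hσ s hs, ← hσ t ht, hst]

theorem image_subset (h : IsLocalParam l Γ U μ) : μ '' U ⊆ Γ := by
  obtain ⟨V, -, hV⟩ := h.exists_isOpen_image
  rw [hV]
  exact Set.inter_subset_left

/-- The restriction of a local parametrization to an open set. -/
theorem mono (h : IsLocalParam l Γ U μ) (hB : IsOpen B) (hBU : B ⊆ U) :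
    IsLocalParam l Γ B μ := by
  obtain ⟨σ, hσc, hσ⟩ := h.exists_continuous_inverse
  refine ⟨hB, h.contDiffOn.mono hBU, fun s hs => h.injective_fderiv s (hBU hs), ?_,
    σ, hσc.mono (Set.image_mono hBU), fun s hs => hσ s (hBU hs)⟩
  obtain ⟨V, hV, hUV⟩ := h.exists_isOpen_image
  -- Inside `μ '' U` the image of `B` is the preimage of `B` under the continuous inverse, hence
  -- relatively open.
  obtain ⟨W, hW, hWσ⟩ := continuousOn_iff'.mp hσc B hB
  refine ⟨V ∩ W, hV.inter hW, ?_⟩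
  rw [← Set.inter_assoc, ← hUV, Set.inter_comm, ← hWσ]
  ext z
  constructor
  · rintro ⟨s, hs, rfl⟩
    exact ⟨by simpa [hσ s (hBU hs)] using hs, s, hBU hs, rfl⟩
  · rintro ⟨hz, s, hs, rfl⟩
    exact ⟨s, by simpa [hσ s hs] using hz, rfl⟩

theorem contDiffAt (h : IsLocalParam l Γ U μ) {s : R2} (hs : s ∈ U) : ContDiffAt ℝ l μ s :=
  h.contDiffOn.contDiffAt (h.isOpen_source.mem_nhds hs)

theorem tendsto_nhdsWithin (h : IsLocalParam l Γ U μ) {s : R2} (hs : s ∈ U) :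
    Tendsto μ (𝓝 s) (𝓝[Γ] (μ s)) := by
  refine tendsto_nhdsWithin_iff.mpr ⟨(h.contDiffAt hs).continuousAt, ?_⟩
  filter_upwards [h.isOpen_source.mem_nhds hs] with t ht
    using h.image_subset (Set.mem_image_of_mem μ ht)

theorem contDiffAt_comp {F : Type*} [NormedAddCommGroup F] [NormedSpace ℝ F] {η : R3 → F} {m : ℕ}
    (h : IsLocalParam l Γ U μ) (hm : m ≤ l) {s : R2} (hs : s ∈ U) (hη : IsCmAt m η Γ (μ s)) :
    ContDiffAt ℝ m (fun t => η (μ t)) s := by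
  obtain ⟨η', h1, h2⟩ := hη
  exact (h1.comp s ((h.contDiffAt hs).of_le (by exact_mod_cast hm))).congr_of_eventuallyEq
    (h.tendsto_nhdsWithin hs |>.eventually h2.symm)

variable {S : ClosedSurface l}

theorem sum_fderiv_mul_normal (h : IsLocalParam l S.carrier U μ) {s : R2} (hs : s ∈ U) (w : R2) :
    ∑ i, fderiv ℝ μ s w i * S.normal (μ s) i = 0 := by
  rw [← ClosedSurface.inner_eq_sum, real_inner_comm]
  exact S.normal_orthogonal U μ h s hs w

/-- The chain rule in a local parametrization. -/
theorem hasFDerivAt_comp (hl : 1 ≤ l) (h : IsLocalParam l S.carrier U μ) {s : R2} (hs : s ∈ U)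
    {η : R3 → ℝ} (hη : IsCmAt 1 η S.carrier (μ s)) :
    ∃ L : R2 →L[ℝ] ℝ, HasFDerivAt (fun t => η (μ t)) L s ∧
      ∀ w, L w = ∑ i, fderiv ℝ μ s w i * S.tanDeriv i η (μ s) := by
  obtain ⟨η', h1, h2⟩ := hη
  have hy := h.image_subset (Set.mem_image_of_mem μ hs)
  norm_cast at h1
  have hμd : HasFDerivAt μ (fderiv ℝ μ s) s :=
    ((h.contDiffAt hs).differentiableAt (by exact_mod_cast (by omega : l ≠ 0))).hasFDerivAt
  refine ⟨_, ((h1.differentiableAt one_ne_zero).hasFDerivAt.comp s hμd).congr_of_eventuallyEq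
    (h.tendsto_nhdsWithin hs |>.eventually h2.symm), fun w => ?_⟩
  simp only [S.tanDeriv_eq_sub hl hy h1 h2]
  have h0 := h.sum_fderiv_mul_normal hs w
  set v := fderiv ℝ μ s w with hv
  have hvs : v = ∑ i, v i • EuclideanSpace.single i (1 : ℝ) := by
    ext j
    fin_cases j <;> simp [Fin.sum_univ_three]
  rw [ContinuousLinearMap.comp_apply, ← hv]
  conv_lhs => rw [hvs, map_sum]
  simp only [map_smul, smul_eq_mul, Fin.sum_univ_three] at h0 ⊢
  set q := S.normal (μ s) 0 * fderiv ℝ η' (μ s) (EuclideanSpace.single 0 1) +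
    S.normal (μ s) 1 * fderiv ℝ η' (μ s) (EuclideanSpace.single 1 1) +
    S.normal (μ s) 2 * fderiv ℝ η' (μ s) (EuclideanSpace.single 2 1)
  linear_combination q * h0

end IsLocalParam

/-! ### Determinants, the area density and the flux in a chart. -/

/-- The determinant of three vectors of `ℝ³`. -/
def det3 (a b c : Fin 3 → ℝ) : ℝ :=
  a 0 * (b 1 * c 2 - b 2 * c 1) + a 1 * (b 2 * c 0 - b 0 * c 2) + a 2 * (b 0 * c 1 - b 1 * c 0)

/-- Three vectors in the plane orthogonal to `n` are dependent. In the proof, `n` is exchanged for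
one vector after another in the determinant. -/
theorem det3_eq_zero_of_orthogonal {n a b c : Fin 3 → ℝ} (hn : ∑ k, n k * n k = 1)
    (ha : ∑ k, a k * n k = 0) (hb : ∑ k, b k * n k = 0) (hc : ∑ k, c k * n k = 0) :
    det3 a b c = 0 := by
  simp only [Fin.sum_univ_three] at hn ha hb hc
  have e : det3 a b c * (n 0 * n 0 + n 1 * n 1 + n 2 * n 2) =
      (a 0 * n 0 + a 1 * n 1 + a 2 * n 2) * det3 n b c +
      (b 0 * n 0 + b 1 * n 1 + b 2 * n 2) * det3 a n c +
      (c 0 * n 0 + c 1 * n 1 + c 2 * n 2) * det3 a b n := by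
    unfold det3
    ring
  rw [hn, ha, hb, hc] at e
  linarith

/-- The square is the Gram determinant of `n, a, b`, which reduces to that of `a, b` because `n` is
a unit vector orthogonal to both. -/
theorem det3_sq {n a b : Fin 3 → ℝ} (hn : ∑ k, n k * n k = 1)
    (ha : ∑ k, a k * n k = 0) (hb : ∑ k, b k * n k = 0) :
    det3 n a b ^ 2 = (∑ k, a k * a k) * (∑ k, b k * b k) - (∑ k, a k * b k) ^ 2 := by
  simp only [Fin.sum_univ_three] at hn ha hb ⊢
  have e : det3 n a b ^ 2 = (n 0 * n 0 + n 1 * n 1 + n 2 * n 2) *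
      ((a 0 * a 0 + a 1 * a 1 + a 2 * a 2) * (b 0 * b 0 + b 1 * b 1 + b 2 * b 2) -
        (a 0 * b 0 + a 1 * b 1 + a 2 * b 2) ^ 2) -
      (a 0 * n 0 + a 1 * n 1 + a 2 * n 2) * ((a 0 * n 0 + a 1 * n 1 + a 2 * n 2) *
        (b 0 * b 0 + b 1 * b 1 + b 2 * b 2) - (a 0 * b 0 + a 1 * b 1 + a 2 * b 2) *
        (b 0 * n 0 + b 1 * n 1 + b 2 * n 2)) +
      (b 0 * n 0 + b 1 * n 1 + b 2 * n 2) * ((a 0 * b 0 + a 1 * b 1 + a 2 * b 2) *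
        (a 0 * n 0 + a 1 * n 1 + a 2 * n 2) - (a 0 * a 0 + a 1 * a 1 + a 2 * a 2) *
        (b 0 * n 0 + b 1 * n 1 + b 2 * n 2)) := by
    unfold det3
    ring
  rw [e, hn, ha, hb]
  ring

/-- The trace as the derivative of the determinant, for a matrix annihilating the first vector. -/
theorem det3_add_det3_eq_trace_mul {n a b : Fin 3 → ℝ} {D : Fin 3 → Fin 3 → ℝ}
    (hD : ∀ k, ∑ i, n i * D i k = 0) :
    det3 n (fun k => ∑ i, a i * D i k) b + det3 n a (fun k => ∑ i, b i * D i k) =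
      det3 n a b * ∑ i, D i i := by
  have h0 := hD 0
  have h1 := hD 1
  have h2 := hD 2
  simp only [Fin.sum_univ_three, det3] at *
  linear_combination -(a 1 * b 2 - a 2 * b 1) * h0 - (a 2 * b 0 - a 0 * b 2) * h1 -
    (a 0 * b 1 - a 1 * b 0) * h2

theorem hasFDerivAt_det3 {E : Type*} [NormedAddCommGroup E] [NormedSpace ℝ E]
    {a b c : E → Fin 3 → ℝ} {s : E} {a' b' c' : Fin 3 → E →L[ℝ] ℝ}
    (ha : ∀ k, HasFDerivAt (fun t => a t k) (a' k) s)
    (hb : ∀ k, HasFDerivAt (fun t => b t k) (b' k) s)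
    (hc : ∀ k, HasFDerivAt (fun t => c t k) (c' k) s) :
    ∃ L : E →L[ℝ] ℝ, HasFDerivAt (fun t => det3 (a t) (b t) (c t)) L s ∧ ∀ w, L w =
      det3 (fun k => a' k w) (b s) (c s) + det3 (a s) (fun k => b' k w) (c s) +
        det3 (a s) (b s) (fun k => c' k w) := by
  refine ⟨_, (((ha 0).mul (((hb 1).mul (hc 2)).sub ((hb 2).mul (hc 1)))).add
    ((ha 1).mul (((hb 2).mul (hc 0)).sub ((hb 0).mul (hc 2))))).add
    ((ha 2).mul (((hb 0).mul (hc 1)).sub ((hb 1).mul (hc 0)))), fun w => ?_⟩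
  simp [det3]
  ring

theorem contDiffAt_det3 {E : Type*} [NormedAddCommGroup E] [NormedSpace ℝ E]
    {a b c : E → Fin 3 → ℝ} {s : E} {m : ℕ} (ha : ∀ k, ContDiffAt ℝ m (fun t => a t k) s)
    (hb : ∀ k, ContDiffAt ℝ m (fun t => b t k) s) (hc : ∀ k, ContDiffAt ℝ m (fun t => c t k) s) :
    ContDiffAt ℝ m (fun t => det3 (a t) (b t) (c t)) s :=
  (((ha 0).mul (((hb 1).mul (hc 2)).sub ((hb 2).mul (hc 1)))).add
    ((ha 1).mul (((hb 2).mul (hc 0)).sub ((hb 0).mul (hc 2))))).add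
    ((ha 2).mul (((hb 0).mul (hc 1)).sub ((hb 1).mul (hc 0))))

theorem integral_fderiv_apply_eq_zero {g : R2 → ℝ} (hg : ContDiff ℝ 1 g) (hc : HasCompactSupport g)
    (w : R2) : ∫ s, fderiv ℝ g s w = 0 := by
  have h := integral_mul_fderiv_eq_neg_fderiv_mul_of_integrable (μ := (volume : Measure R2))
    (f := fun _ : R2 => (1 : ℝ)) (g := g) (v := w) (by simp) ?_ ?_ (fun _ _ => by fun_prop)
    fun s _ => (hg.differentiable one_ne_zero) s
  · simpa using h
  · simp only [one_mul]
    exact Continuous.integrable_of_hasCompactSupport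
      ((hg.continuous_fderiv one_ne_zero).clm_apply continuous_const) (hc.fderiv_apply ℝ w)
  · simpa using hg.continuous.integrable_of_hasCompactSupport hc

namespace IsLocalParam

variable {l : ℕ} {U : Set R2} {μ : R2 → R3} {S : ClosedSurface l}

/-- The signed area density of a local parametrization. -/
def areaDet (S : ClosedSurface l) (μ : R2 → R3) (s : R2) : ℝ :=
  det3 (fun k => S.normal (μ s) k) (fun k => fderiv ℝ μ s (EuclideanSpace.single 0 1) k)
    (fun k => fderiv ℝ μ s (EuclideanSpace.single 1 1) k)

theorem normDet_pos (h : IsLocalParam l S.carrier U μ) {s : R2} (hs : s ∈ U) :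
    0 < (fderiv ℝ μ s).toLinearMap.normDet :=
  lt_of_le_of_ne (LinearMap.normDet_nonneg _)
    (Ne.symm (((fderiv ℝ μ s).toLinearMap.normDet_ne_zero_tfae.out 0 4).mpr
      (h.injective_fderiv s hs)))

/-- The squares of both sides are the Gram determinant of the coordinate vectors. The signed density
is preferred because it is multilinear and can be differentiated without square roots. -/
theorem abs_areaDet (h : IsLocalParam l S.carrier U μ) {s : R2} (hs : s ∈ U) :
    |areaDet S μ s| = (fderiv ℝ μ s).toLinearMap.normDet := by
  have hy := h.image_subset (Set.mem_image_of_mem μ hs)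
  rw [← abs_of_nonneg (LinearMap.normDet_nonneg (fderiv ℝ μ s).toLinearMap), ← sq_eq_sq_iff_abs_eq_abs]
  have h1 := (fderiv ℝ μ s).toLinearMap.normDet_sq_eq_det_gram (EuclideanSpace.basisFun (Fin 2) ℝ)
  have h2 : (fderiv ℝ μ s).toLinearMap.normDet ^ 2 = _ := h1
  rw [h2, areaDet, det3_sq (S.sum_normal_mul_self hy) (h.sum_fderiv_mul_normal hs _)
    (h.sum_fderiv_mul_normal hs _), Matrix.det_fin_two]
  simp only [Matrix.gram_apply, EuclideanSpace.basisFun_apply, ContinuousLinearMap.coe_coe,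
    ClosedSurface.inner_eq_sum, Fin.sum_univ_three]
  ring

theorem contDiffAt_fderiv_apply (hl : 2 ≤ l) (h : IsLocalParam l S.carrier U μ) {s : R2}
    (hs : s ∈ U) (w : R2) (k : Fin 3) : ContDiffAt ℝ (1 : ℕ) (fun t => fderiv ℝ μ t w k) s := by
  have h1 : ContDiffAt ℝ (1 : ℕ) (fderiv ℝ μ) s :=
    (h.contDiffAt hs).fderiv_right (by exact_mod_cast hl)
  exact (EuclideanSpace.proj k : R3 →L[ℝ] ℝ).contDiff.contDiffAt.comp s
    (h1.clm_apply contDiffAt_const)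

theorem contDiffAt_areaDet (hl : 2 ≤ l) (h : IsLocalParam l S.carrier U μ) {s : R2} (hs : s ∈ U) :
    ContDiffAt ℝ (1 : ℕ) (areaDet S μ) s :=
  contDiffAt_det3 (fun k => h.contDiffAt_comp (by omega) hs (S.isCmAt_normal_apply (by omega)
      (h.image_subset (Set.mem_image_of_mem μ hs)) k))
    (h.contDiffAt_fderiv_apply hl hs _) (h.contDiffAt_fderiv_apply hl hs _)

/-- The surface divergence of a tangential field in a local parametrization. -/
theorem exists_hasFDerivAt_flux (hl : 2 ≤ l) (h : IsLocalParam l S.carrier U μ) {s : R2}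
    (hs : s ∈ U) {Y : R3 → R3} (hY : S.IsTangentialAt 1 Y (μ s)) :
    ∃ L₀ L₁ : R2 →L[ℝ] ℝ,
      HasFDerivAt (fun t => det3 (fun k => S.normal (μ t) k) (fun k => Y (μ t) k)
        (fun k => fderiv ℝ μ t (EuclideanSpace.single 1 1) k)) L₀ s ∧
      HasFDerivAt (fun t => det3 (fun k => S.normal (μ t) k)
        (fun k => fderiv ℝ μ t (EuclideanSpace.single 0 1) k) (fun k => Y (μ t) k)) L₁ s ∧
      L₀ (EuclideanSpace.single 0 1) + L₁ (EuclideanSpace.single 1 1) =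
        areaDet S μ s * S.div Y (μ s) := by
  have hy := h.image_subset (Set.mem_image_of_mem μ hs)
  set e₀ : R2 := EuclideanSpace.single 0 1
  set e₁ : R2 := EuclideanSpace.single 1 1
  choose Y' hY' hY'' using fun k => h.hasFDerivAt_comp (by omega) hs (hY.coord k)
  choose N' hN' hN'' using fun k => h.hasFDerivAt_comp (by omega) hs
    (S.isCmAt_normal_apply (m := 1) (by omega) hy k)
  have hm : ∀ (w : R2) (k : Fin 3), HasFDerivAt (fun t => fderiv ℝ μ t w k)
      (fderiv ℝ (fun t => fderiv ℝ μ t w k) s) s := fun w k =>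
    ((h.contDiffAt_fderiv_apply hl hs w k).differentiableAt (by simp)).hasFDerivAt
  -- The mixed second derivatives of `μ` occur in the two fluxes in opposite slots of the
  -- determinant, so they cancel once they are known to agree.
  have hsymm : ∀ k, fderiv ℝ (fun t => fderiv ℝ μ t e₁ k) s e₀ =
      fderiv ℝ (fun t => fderiv ℝ μ t e₀ k) s e₁ := by
    intro k
    have h2 : ContDiffAt ℝ 2 μ s := (h.contDiffAt hs).of_le (by exact_mod_cast hl)
    have hs2 : IsSymmSndFDerivAt ℝ μ s := h2.isSymmSndFDerivAt (by simp)
    have hd : DifferentiableAt ℝ (fderiv ℝ μ) s :=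
      (h2.fderiv_right (m := 1) (by norm_cast)).differentiableAt one_ne_zero
    have he : ∀ w v : R2, fderiv ℝ (fun t => fderiv ℝ μ t w k) s v =
        fderiv ℝ (fderiv ℝ μ) s v w k := by
      intro w v
      have hw : HasFDerivAt (fun t => fderiv ℝ μ t w) _ s :=
        hd.hasFDerivAt.clm_apply (hasFDerivAt_const w s)
      have := ((EuclideanSpace.proj k : R3 →L[ℝ] ℝ).hasFDerivAt.comp s hw).fderiv
      change fderiv ℝ ((EuclideanSpace.proj k : R3 →L[ℝ] ℝ) ∘ fun t => fderiv ℝ μ t w) s v = _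
      rw [this]
      simp
    rw [he, he, hs2]
  obtain ⟨L₀, hL₀, hL₀'⟩ := hasFDerivAt_det3 hN' hY' (hm e₁)
  obtain ⟨L₁, hL₁, hL₁'⟩ := hasFDerivAt_det3 hN' (hm e₀) hY'
  refine ⟨L₀, L₁, hL₀, hL₁, ?_⟩
  rw [hL₀', hL₁']
  have hn := S.sum_normal_mul_self hy
  have hYn := hY.sum_eq_zero hy
  have hNn : ∀ w, ∑ k, N' k w * S.normal (μ s) k = 0 := by
    intro w
    have h' := fun i => ClosedSurface.sum_normalDeriv_mul_normal (S := S) hl hy i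
    have h0 := h' 0
    have h1 := h' 1
    have h2 := h' 2
    simp only [hN'', Fin.sum_univ_three, ClosedSurface.normalDeriv] at h0 h1 h2 ⊢
    linear_combination fderiv ℝ μ s w 0 * h0 + fderiv ℝ μ s w 1 * h1 + fderiv ℝ μ s w 2 * h2
  -- Derivatives of the unit normal are tangential, so these determinants have three tangential
  -- entries.
  rw [det3_eq_zero_of_orthogonal hn (hNn e₀) hYn (h.sum_fderiv_mul_normal hs e₁),
    det3_eq_zero_of_orthogonal hn (hNn e₁) (h.sum_fderiv_mul_normal hs e₀) hYn]
  -- The terms that are left differentiate `Y` only. They are the derivative of an area under the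
  -- matrix of `D_i Y_k`, whose trace is the divergence.
  have htr := det3_add_det3_eq_trace_mul (n := fun k => S.normal (μ s) k)
    (a := fun k => fderiv ℝ μ s e₀ k) (b := fun k => fderiv ℝ μ s e₁ k)
    (D := fun i k => S.tanDeriv i (fun z => Y z k) (μ s))
    fun k => S.sum_normal_mul_tanDeriv hy fun z => Y z k
  change _ = areaDet S μ s * S.div Y (μ s) at htr
  rw [← htr]
  simp only [hY'', hsymm]
  unfold det3
  ring

end IsLocalParam

/-! ### The divergence theorem on a closed surface. -/

open scoped Manifold ContDiff

namespace IsLocalParam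

variable {l : ℕ} {U : Set R2} {μ : R2 → R3} {S : ClosedSurface l}

theorem contDiffOn_one (hl : 1 ≤ l) (h : IsLocalParam l S.carrier U μ) : ContDiffOn ℝ 1 μ U :=
  h.contDiffOn.of_le (by exact_mod_cast hl)

theorem measure_image (hl : 1 ≤ l) (h : IsLocalParam l S.carrier U μ) {A : Set R2}
    (hA : MeasurableSet A) (hAU : A ⊆ U) :
    μHE[2] (μ '' A) = ∫⁻ s in A, ENNReal.ofReal (fderiv ℝ μ s).toLinearMap.normDet := by
  have := euclideanHausdorffMeasure_image_eq_lintegral h.isOpen_source (h.contDiffOn_one hl)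
    h.injective_fderiv h.injOn hA hAU
  rwa [finrank_R2] at this

theorem setIntegral_image (hl : 1 ≤ l) (h : IsLocalParam l S.carrier U μ) {φ : R3 → ℝ}
    (hφ : ContinuousOn φ S.carrier) :
    ∫ y in μ '' U, φ y ∂μHE[2] = ∫ s in U, (fderiv ℝ μ s).toLinearMap.normDet * φ (μ s) := by
  have := setIntegral_image_euclideanHausdorffMeasure h.isOpen_source (h.contDiffOn_one hl)
    h.injective_fderiv h.injOn (hφ.mono h.image_subset)
  rwa [finrank_R2] at this

/-- The flux of a tangential field supported in a coordinate patch vanishes. -/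
theorem setIntegral_areaDet_mul_div (hl : 2 ≤ l) (h : IsLocalParam l S.carrier U μ)
    {Y : R3 → R3} (hY : S.IsTangential 1 Y) {K : Set R3} (hK : IsClosed K)
    (hKU : S.carrier ∩ K ⊆ μ '' U) (hY0 : ∀ z ∈ S.carrier, z ∉ K → Y z = 0) :
    ∫ s in U, areaDet S μ s * S.div Y (μ s) = 0 := by
  obtain ⟨σ, hσc, hσ⟩ := h.exists_continuous_inverse
  set K' : Set R2 := σ '' (S.carrier ∩ K) with hK'def
  have hK' : IsCompact K' := (S.isCompact.inter_right hK).image_of_continuousOn (hσc.mono hKU)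
  have hK'U : K' ⊆ U := by
    rintro _ ⟨z, hz, rfl⟩
    obtain ⟨s, hs, rfl⟩ := hKU hz
    rwa [hσ s hs]
  have hmem : ∀ s ∈ U, s ∉ K' → Y (μ s) = 0 := by
    intro s hs hsK
    have hsΓ := h.image_subset (Set.mem_image_of_mem μ hs)
    refine hY0 _ hsΓ fun hμK => hsK ⟨μ s, ⟨hsΓ, hμK⟩, hσ s hs⟩
  have hYU : ∀ s ∈ U, S.IsTangentialAt 1 Y (μ s) := fun s hs =>
    hY.isTangentialAt (h.image_subset (Set.mem_image_of_mem μ hs))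
  -- The support lies over the compact set `K' ⊆ U`, so a `C¹` function on `U` vanishing off `K'`
  -- extends by zero to a compactly supported `C¹` function on the plane.
  have hext : ∀ f : R2 → ℝ, (∀ s ∈ U, ContDiffAt ℝ (1 : ℕ) f s) → (∀ s ∈ U, s ∉ K' → f s = 0) →
      ContDiff ℝ 1 (U.indicator f) ∧ HasCompactSupport (U.indicator f) ∧
      (∀ s ∈ U, fderiv ℝ (U.indicator f) s = fderiv ℝ f s) ∧
      ∀ s ∉ U, fderiv ℝ (U.indicator f) s = 0 := by
    intro f hf hf0
    have hin : ∀ s ∈ U, U.indicator f =ᶠ[𝓝 s] f := fun s hs => by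
      filter_upwards [h.isOpen_source.mem_nhds hs] with t ht using Set.indicator_of_mem ht f
    have hz : ∀ s ∉ K', U.indicator f s = 0 := by
      intro s hs
      by_cases hsU : s ∈ U
      · rw [Set.indicator_of_mem hsU, hf0 s hsU hs]
      · exact Set.indicator_of_notMem hsU f
    have hout : ∀ s ∉ K', U.indicator f =ᶠ[𝓝 s] fun _ => 0 := fun s hs => by
      filter_upwards [hK'.isClosed.isOpen_compl.mem_nhds hs] with t ht using hz t ht
    refine ⟨contDiff_iff_contDiffAt.mpr fun s => ?_, HasCompactSupport.intro hK' hz,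
      fun s hs => (hin s hs).fderiv_eq, fun s hs => ?_⟩
    · by_cases hsU : s ∈ U
      · exact (hf s hsU).congr_of_eventuallyEq (hin s hsU)
      · exact contDiffAt_const.congr_of_eventuallyEq (hout s fun hs => hsU (hK'U hs))
    · rw [(hout s fun hs' => hs (hK'U hs')).fderiv_eq]
      simp
  have hn : ∀ s ∈ U, ∀ k, ContDiffAt ℝ (1 : ℕ) (fun t => S.normal (μ t) k) s := fun s hs k =>
    h.contDiffAt_comp (by omega) hs (S.isCmAt_normal_apply (by omega)
      (h.image_subset (Set.mem_image_of_mem μ hs)) k)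
  have hYc : ∀ s ∈ U, ∀ k, ContDiffAt ℝ (1 : ℕ) (fun t => Y (μ t) k) s := fun s hs k =>
    h.contDiffAt_comp (by omega) hs ((hYU s hs).coord k)
  set f₀ : R2 → ℝ := fun t => det3 (fun k => S.normal (μ t) k) (fun k => Y (μ t) k)
    (fun k => fderiv ℝ μ t (EuclideanSpace.single 1 1) k)
  set f₁ : R2 → ℝ := fun t => det3 (fun k => S.normal (μ t) k)
    (fun k => fderiv ℝ μ t (EuclideanSpace.single 0 1) k) (fun k => Y (μ t) k)
  obtain ⟨c₀, d₀, i₀, o₀⟩ := hext f₀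
    (fun s hs => contDiffAt_det3 (hn s hs) (hYc s hs) (h.contDiffAt_fderiv_apply hl hs _))
    fun s hs hsK => by simp [f₀, hmem s hs hsK, det3]
  obtain ⟨c₁, d₁, i₁, o₁⟩ := hext f₁
    (fun s hs => contDiffAt_det3 (hn s hs) (h.contDiffAt_fderiv_apply hl hs _) (hYc s hs))
    fun s hs hsK => by simp [f₁, hmem s hs hsK, det3]
  have hint : ∀ {g : R2 → ℝ} (w : R2), ContDiff ℝ 1 g → HasCompactSupport g →
      Integrable fun s => fderiv ℝ g s w := fun {g} w hg hc =>
    ((hg.continuous_fderiv one_ne_zero).clm_apply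
      continuous_const).integrable_of_hasCompactSupport (hc.fderiv_apply ℝ w)
  calc ∫ s in U, areaDet S μ s * S.div Y (μ s)
      = ∫ s in U, (fderiv ℝ (U.indicator f₀) s (EuclideanSpace.single 0 1) +
          fderiv ℝ (U.indicator f₁) s (EuclideanSpace.single 1 1)) := by
        refine setIntegral_congr_fun h.isOpen_source.measurableSet fun s hs => ?_
        obtain ⟨L₀, L₁, h0, h1, h2⟩ := h.exists_hasFDerivAt_flux hl hs (hYU s hs)
        rw [i₀ s hs, i₁ s hs, h0.fderiv, h1.fderiv, h2]
    _ = ∫ s, (fderiv ℝ (U.indicator f₀) s (EuclideanSpace.single 0 1) +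
          fderiv ℝ (U.indicator f₁) s (EuclideanSpace.single 1 1)) := by
        refine setIntegral_eq_integral_of_forall_compl_eq_zero fun s hs => ?_
        rw [o₀ s hs, o₁ s hs]
        simp
    _ = 0 := by
        rw [integral_add (hint _ c₀ d₀) (hint _ c₁ d₁), integral_fderiv_apply_eq_zero c₀ d₀,
          integral_fderiv_apply_eq_zero c₁ d₁, add_zero]

end IsLocalParam

namespace ClosedSurface

variable {l : ℕ} (S : ClosedSurface l) {y : R3} {X Y : R3 → R3}

theorem isCmAt_div {m : ℕ} (hm : m + 1 ≤ l) (hy : y ∈ S.carrier)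
    (hX : IsCmAt (m + 1) X S.carrier y) : IsCmAt m (S.div X) S.carrier y :=
  IsCmAt.sum (η := fun i => S.tanDeriv i fun z => X z i) (s := Finset.univ) fun i _ =>
    S.isCmAt_tanDeriv hm hy (hX.coord i) i

theorem continuousOn_div (hl : 2 ≤ l) (hX : S.IsTangential 1 X) :
    ContinuousOn (S.div X) S.carrier := fun _ hy =>
  (S.isCmAt_div (m := 0) (by omega) hy (hX.1 _ hy)).continuousWithinAt hy

theorem div_apply (X : R3 → R3) (y : R3) :
    S.div X y = ∑ i, S.tanDeriv i (fun z => X z i) y := rfl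

theorem div_congr (hy : y ∈ S.carrier) (h : X =ᶠ[𝓝[S.carrier] y] Y) : S.div X y = S.div Y y := by
  rw [div_apply, div_apply]
  refine Finset.sum_congr rfl fun i _ => ?_
  exact S.tanDeriv_congr hy (h.mono fun z hz => by simp only [hz])

theorem div_sum (hl : 1 ≤ l) (hy : y ∈ S.carrier) {ι : Type*} {s : Finset ι} {X : ι → R3 → R3}
    (hX : ∀ j ∈ s, IsCmAt 1 (X j) S.carrier y) :
    S.div (fun z => ∑ j ∈ s, X j z) y = ∑ j ∈ s, S.div (X j) y := by
  simp only [div_apply]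
  rw [Finset.sum_comm]
  refine Finset.sum_congr rfl fun i _ => ?_
  rw [← S.tanDeriv_sum hl hy fun j hj => (hX j hj).coord i]
  simp

/-- The divergence theorem for fields supported in a coordinate patch. -/
theorem exists_isOpen_integral_div_eq_zero (hl : 2 ≤ l) (hy : y ∈ S.carrier) :
    ∃ V, IsOpen V ∧ y ∈ V ∧ ∀ (Y : R3 → R3) (K : Set R3), S.IsTangential 1 Y → IsClosed K →
      K ⊆ V → (∀ z ∈ S.carrier, z ∉ K → Y z = 0) → ∫ z in S.carrier, S.div Y z ∂μHE[2] = 0 := by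
  obtain ⟨U, μ, hμ, s₀, hs₀, rfl⟩ := S.exists_param y hy
  -- The chart is shrunk to the parameters where the signed density has the sign it has at `s₀`,
  -- since `U` need not be connected. There the area density is a constant sign times `areaDet`.
  set B : Set R2 := U ∩ {s | 0 < IsLocalParam.areaDet S μ s₀ * IsLocalParam.areaDet S μ s}
  have hjc : ContinuousOn (IsLocalParam.areaDet S μ) U := fun s hs =>
    (hμ.contDiffAt_areaDet hl hs).continuousAt.continuousWithinAt
  have hB : IsOpen B := (continuousOn_const.mul hjc).isOpen_inter_preimage hμ.isOpen_source
    isOpen_Ioi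
  have hBμ := hμ.mono hB Set.inter_subset_left
  obtain ⟨V, hV, hBV⟩ := hBμ.exists_isOpen_image
  have hj0 : IsLocalParam.areaDet S μ s₀ ≠ 0 := by
    rw [← abs_pos, hμ.abs_areaDet hs₀]
    exact hμ.normDet_pos hs₀
  have hs₀B : s₀ ∈ B := ⟨hs₀, mul_self_pos.mpr hj0⟩
  refine ⟨V, hV, (hBV ▸ Set.mem_image_of_mem μ hs₀B : μ s₀ ∈ S.carrier ∩ V).2, ?_⟩
  intro Y K hY hK hKV hY0
  have hdiv0 : ∀ z ∈ S.carrier, z ∉ K → S.div Y z = 0 := by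
    intro z hz hzK
    rw [S.div_congr hz (Y := fun _ => 0)]
    · rw [div_apply]
      exact Finset.sum_eq_zero fun i _ => S.tanDeriv_const (by omega) hz 0
    · filter_upwards [self_mem_nhdsWithin,
        mem_nhdsWithin_of_mem_nhds (hK.isOpen_compl.mem_nhds hzK)] with w h1 h2 using hY0 w h1 h2
  have hmeas : MeasurableSet S.carrier := S.isCompact.measurableSet
  have e1 : ∫ z in S.carrier, S.div Y z ∂μHE[2] = ∫ z in μ '' B, S.div Y z ∂μHE[2] := by
    rw [hBV]
    refine setIntegral_eq_of_subset_of_forall_sdiff_eq_zero hmeas Set.inter_subset_left ?_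
    exact fun z hz => hdiv0 z hz.1 fun hzK => hz.2 ⟨hz.1, hKV hzK⟩
  rw [e1, hBμ.setIntegral_image (by omega) (S.continuousOn_div hl hY)]
  have e2 : ∀ s ∈ B, (fderiv ℝ μ s).toLinearMap.normDet * S.div Y (μ s) =
      (SignType.sign (IsLocalParam.areaDet S μ s₀) : ℝ) *
        (IsLocalParam.areaDet S μ s * S.div Y (μ s)) := by
    intro s hs
    have hpos : 0 < IsLocalParam.areaDet S μ s₀ * IsLocalParam.areaDet S μ s := hs.2
    rw [← hμ.abs_areaDet hs.1, ← mul_assoc]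
    congr 1
    rcases hj0.lt_or_gt with h | h
    · rw [abs_of_neg (by nlinarith), sign_neg h]
      simp
    · rw [abs_of_pos (by nlinarith), sign_pos h]
      simp
  rw [setIntegral_congr_fun hB.measurableSet e2, integral_const_mul,
    hBμ.setIntegral_areaDet_mul_div hl hY hK (by rw [hBV]; exact Set.inter_subset_inter_right _ hKV)
      hY0, mul_zero]

/-- The area density is bounded near each parameter, and `Γ` is compact. Finiteness makes every
function continuous on `Γ` integrable. -/
theorem measure_carrier_lt_top (hl : 1 ≤ l) : (μHE[2] : Measure R3) S.carrier < ⊤ := by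
  refine S.isCompact.measure_lt_top_of_nhdsWithin fun y hy => ?_
  obtain ⟨U, μ, hμ, s₀, hs₀, rfl⟩ := S.exists_param y hy
  have hJ : ContinuousOn (fun s => (fderiv ℝ μ s).toLinearMap.normDet) U :=
    LinearMap.continuous_normDet.comp_continuousOn
      ((hμ.contDiffOn_one hl).continuousOn_fderiv_of_isOpen hμ.isOpen_source le_rfl)
  have hUs := hμ.isOpen_source.mem_nhds hs₀
  set c := (fderiv ℝ μ s₀).toLinearMap.normDet + 1
  have h1 := (hJ.continuousAt hUs).eventually (gt_mem_nhds (lt_add_one _))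
  obtain ⟨ε, hε, hball⟩ := Metric.mem_nhds_iff.mp (inter_mem hUs h1)
  have hBU : Metric.ball s₀ ε ⊆ U := fun s hs => (hball hs).1
  have hBμ := hμ.mono Metric.isOpen_ball hBU
  obtain ⟨V, hV, hBV⟩ := hBμ.exists_isOpen_image
  have hsB := Metric.mem_ball_self (x := s₀) hε
  refine ⟨μ '' Metric.ball s₀ ε, ?_, ?_⟩
  · rw [hBV]
    exact inter_mem self_mem_nhdsWithin (mem_nhdsWithin_of_mem_nhds (hV.mem_nhds
      (hBV ▸ Set.mem_image_of_mem μ hsB : μ s₀ ∈ S.carrier ∩ V).2))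
  · rw [hμ.measure_image hl measurableSet_ball hBU]
    calc ∫⁻ s in Metric.ball s₀ ε, ENNReal.ofReal (fderiv ℝ μ s).toLinearMap.normDet
        ≤ ∫⁻ s in Metric.ball s₀ ε, ENNReal.ofReal c :=
          setLIntegral_mono' measurableSet_ball fun s hs =>
            ENNReal.ofReal_le_ofReal (hball hs).2.le
      _ < ⊤ := by
          rw [setLIntegral_const]
          exact ENNReal.mul_lt_top ENNReal.ofReal_lt_top measure_ball_lt_top

/-- Nonempty relatively open sets have positive area, as the density of a chart is positive. This
lets a vanishing integral of a nonnegative continuous function be read pointwise. -/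
theorem measure_carrier_inter_pos (hl : 1 ≤ l) (hy : y ∈ S.carrier) {V : Set R3} (hV : IsOpen V)
    (hyV : y ∈ V) : 0 < (μHE[2] : Measure R3) (S.carrier ∩ V) := by
  obtain ⟨U, μ, hμ, s₀, hs₀, rfl⟩ := S.exists_param y hy
  have hB : IsOpen (U ∩ μ ⁻¹' V) :=
    hμ.contDiffOn.continuousOn.isOpen_inter_preimage hμ.isOpen_source hV
  have hne : (U ∩ μ ⁻¹' V).Nonempty := ⟨s₀, hs₀, hyV⟩
  refine lt_of_lt_of_le ?_ (measure_mono (s := μ '' (U ∩ μ ⁻¹' V)) ?_)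
  · rw [hμ.measure_image hl hB.measurableSet Set.inter_subset_left]
    rw [setLIntegral_pos_iff]
    · refine lt_of_lt_of_le (hB.measure_pos volume hne) (measure_mono fun s hs => ⟨?_, hs⟩)
      simpa using hμ.normDet_pos hs.1
    · have hJ : Measurable fun L : R2 →L[ℝ] R3 => L.toLinearMap.normDet :=
        LinearMap.continuous_normDet.measurable
      exact (hJ.comp (measurable_fderiv ℝ μ)).ennreal_ofReal
  · rintro _ ⟨s, hs, rfl⟩
    exact ⟨hμ.image_subset (Set.mem_image_of_mem μ hs.1), hs.2⟩

theorem integrableOn_of_continuousOn (hl : 1 ≤ l) {φ : R3 → ℝ} (hφ : ContinuousOn φ S.carrier) :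
    IntegrableOn φ S.carrier μHE[2] := by
  obtain ⟨C, hC⟩ := S.isCompact.exists_bound_of_continuousOn hφ
  exact IntegrableOn.of_bound (S.measure_carrier_lt_top hl)
    (hφ.aestronglyMeasurable S.isCompact.measurableSet) C
    ((ae_restrict_iff' S.isCompact.measurableSet).mpr (ae_of_all _ hC))

theorem eq_zero_of_integral_eq_zero (hl : 1 ≤ l) {φ : R3 → ℝ} (hφ : ContinuousOn φ S.carrier)
    (h0 : ∀ z ∈ S.carrier, 0 ≤ φ z) (hint : ∫ z in S.carrier, φ z ∂μHE[2] = 0)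
    (hy : y ∈ S.carrier) : φ y = 0 := by
  by_contra hne
  have hmeas := S.isCompact.measurableSet
  have hae := (setIntegral_eq_zero_iff_of_nonneg_ae
    ((ae_restrict_iff' hmeas).mpr (ae_of_all _ h0)) (S.integrableOn_of_continuousOn hl hφ)).mp hint
  obtain ⟨V, hV, hyV, hVφ⟩ := mem_nhdsWithin.mp ((hφ y hy).eventually_ne hne)
  have hpos := S.measure_carrier_inter_pos hl hy hV hyV
  rw [EventuallyEq, ae_restrict_iff' hmeas] at hae
  refine hpos.ne' (measure_mono_null ?_ hae)
  exact fun z hz hz' => hVφ ⟨hz.2, hz.1⟩ (hz' hz.1)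

theorem isTangential_smul {m : ℕ} {χ : R3 → ℝ} (hχ : ContDiff ℝ m χ) (hY : S.IsTangential m Y) :
    S.IsTangential m fun z => χ z • Y z :=
  ⟨fun z hz => (IsCmAt.of_contDiffAt hχ.contDiffAt).smul (hY.1 z hz), fun z hz => by
    rw [inner_smul_left, hY.2 z hz, mul_zero]⟩

/-- The divergence theorem on a closed surface. -/
theorem integral_div_eq_zero (hl : 2 ≤ l) (hY : S.IsTangential 1 Y) :
    ∫ z in S.carrier, S.div Y z ∂μHE[2] = 0 := by
  choose! V hV hyV hVint using
    fun y (hy : y ∈ S.carrier) => S.exists_isOpen_integral_div_eq_zero hl hy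
  obtain ⟨t, htΓ, hcov⟩ := S.isCompact.elim_nhds_subcover V fun y hy => (hV y hy).mem_nhds (hyV y hy)
  -- The functions `ρ i` add up to one on `Γ`. That is enough to split `S.div Y`, which depends only
  -- on values on `Γ`.
  obtain ⟨ρ, hρ⟩ := SmoothPartitionOfUnity.exists_isSubordinate 𝓘(ℝ, R3) S.isCompact.isClosed
    (fun i : t => V i) (fun i => hV i (htΓ i i.2)) (by simpa [Set.iUnion_subtype] using hcov)
  have hρs : ∀ i, ContDiff ℝ (1 : ℕ) (ρ i) := fun i =>
    ((ρ i).contMDiff.contDiff).of_le (by exact_mod_cast le_top)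
  have hT : ∀ i, S.IsTangential 1 fun z => ρ i z • Y z := fun i => S.isTangential_smul (hρs i) hY
  have hsum : ∀ z ∈ S.carrier, S.div Y z = ∑ i, S.div (fun z => ρ i z • Y z) z := by
    intro z hz
    rw [← S.div_sum (by omega) hz fun i _ => (hT i).1 z hz]
    refine S.div_congr hz ?_
    filter_upwards [self_mem_nhdsWithin] with w hw
    have := ρ.sum_eq_one hw
    rw [finsum_eq_sum_of_fintype] at this
    rw [← Finset.sum_smul, this, one_smul]
  rw [setIntegral_congr_fun S.isCompact.measurableSet hsum, integral_finsetSum]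
  · refine Finset.sum_eq_zero fun i _ => ?_
    refine hVint i (htΓ i i.2) _ (tsupport (ρ i)) (hT i) (isClosed_tsupport _) (hρ i) ?_
    intro z _ hz
    rw [image_eq_zero_of_notMem_tsupport hz, zero_smul]
  · exact fun i _ => S.integrableOn_of_continuousOn (by omega) (S.continuousOn_div hl (hT i))

end ClosedSurface

/-! ### Green's formula, uniqueness of the formal adjoint, the Bochner Laplacian. -/

namespace ClosedSurface

variable {l : ℕ} {S : ClosedSurface l} {X Y Z : R3 → R3} {y : R3}

/-- Expand the tangent vector `P e_b = e_b - n_b n` in the basis: its coefficients are the `b`-th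
components of the basis vectors, because these are orthogonal to `n`. -/
theorem sum_stdOrthonormalBasis_mul (hy : y ∈ S.carrier) (a b : Fin 3) :
    ∑ p, (stdOrthonormalBasis ℝ (S.tangentPlane y) p : R3) a *
      (stdOrthonormalBasis ℝ (S.tangentPlane y) p : R3) b = S.P y a b := by
  set τ := stdOrthonormalBasis ℝ (S.tangentPlane y)
  have hτ : ∀ p, ∑ k, (τ p : R3) k * S.normal y k = 0 := fun p => by
    rw [← inner_eq_sum, real_inner_comm]
    exact Submodule.mem_orthogonal_singleton_iff_inner_right.mp (τ p).2
  let x : R3 := EuclideanSpace.single b 1 - S.normal y b • S.normal y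
  have hx : x ∈ S.tangentPlane y := by
    refine Submodule.mem_orthogonal_singleton_iff_inner_right.mpr ?_
    simp only [x]
    rw [inner_sub_right, inner_smul_right, real_inner_self_eq_norm_sq, S.norm_normal y hy]
    simp [EuclideanSpace.inner_single_right]
  have h := congrArg (fun v : S.tangentPlane y => (v : R3) a) (τ.sum_repr' ⟨x, hx⟩)
  have hin : ∀ p, inner ℝ (τ p) (⟨x, hx⟩ : S.tangentPlane y) = (τ p : R3) b := by
    intro p
    rw [Submodule.coe_inner]
    simp only [x]
    rw [inner_sub_right, inner_smul_right, inner_eq_sum _ (S.normal y), hτ p]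
    simp [EuclideanSpace.inner_single_right]
  simp only [hin] at h
  have hxa : x a = S.P y a b := by
    simp only [x, P, Matrix.of_apply, PiLp.sub_apply, PiLp.smul_apply, smul_eq_mul,
      PiLp.single_apply]
    ring
  rw [← hxa, ← h]
  simp [mul_comm]

/-- Parseval's identity in the tangent plane. Only `u` has to be tangential: the normal part of `v`
does not contribute to either side. -/
theorem sum_mul_stdOrthonormalBasis (hy : y ∈ S.carrier) {u v : Fin 3 → ℝ}
    (hu : ∑ k, u k * S.normal y k = 0) :
    ∑ p, (∑ j, u j * (stdOrthonormalBasis ℝ (S.tangentPlane y) p : R3) j) *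
      (∑ j, v j * (stdOrthonormalBasis ℝ (S.tangentPlane y) p : R3) j) = ∑ j, u j * v j := by
  set τ := stdOrthonormalBasis ℝ (S.tangentPlane y)
  calc ∑ p, (∑ j, u j * (τ p : R3) j) * (∑ j, v j * (τ p : R3) j)
      = ∑ j, ∑ k, u j * v k * ∑ p, (τ p : R3) j * (τ p : R3) k := by
        simp only [Fin.sum_univ_three, Finset.mul_sum, ← Finset.sum_add_distrib]
        exact Finset.sum_congr rfl fun p _ => by ring
    _ = ∑ j, u j * v j - (∑ k, u k * S.normal y k) * ∑ k, v k * S.normal y k := by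
        simp only [τ, sum_stdOrthonormalBasis_mul hy, P, Matrix.of_apply, Fin.sum_univ_three]
        simp
        ring
    _ = ∑ j, u j * v j := by rw [hu, zero_mul, sub_zero]

theorem covTensor_apply (X : R3 → R3) (y a b : R3) :
    S.covTensor X y a b = ∑ i, (∑ j, S.covMat X y i j * a j) * b i := by
  rw [covTensor, inner_eq_sum]
  simp only [covDerivAt_apply, covMat_apply, Fin.sum_univ_three]
  ring

/-- `covMat X` is tangential in both indices, so the sums over the basis become a Frobenius product
and the projection of the gradient of `Y` can be dropped. This is the shape the product rule
produces. -/
theorem formInner_covTensor (hy : y ∈ S.carrier) (X Y : R3 → R3) :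
    S.formInner y (S.covTensor X y) (S.covTensor Y y) =
      ∑ i, ∑ j, S.covMat X y i j * S.tanDeriv i (fun z => Y z j) y := by
  have hn : ∀ j, ∑ i, S.covMat X y i j * S.normal y i = 0 := fun j => by
    simpa only [mul_comm] using sum_normal_mul_covMat hy X j
  have hn' := sum_covMat_mul_normal hy X
  unfold formInner
  simp only [covTensor_apply]
  have h1 : ∀ a : R3, ∑ i, (∑ j, S.covMat X y i j * a j) * S.normal y i = 0 := by
    intro a
    have h0 := hn 0
    have h1 := hn 1
    have h2 := hn 2
    simp only [Fin.sum_univ_three] at h0 h1 h2 ⊢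
    linear_combination a 0 * h0 + a 1 * h1 + a 2 * h2
  simp only [sum_mul_stdOrthonormalBasis hy (h1 _)]
  rw [Finset.sum_comm]
  refine Finset.sum_congr rfl fun i _ => ?_
  rw [sum_mul_stdOrthonormalBasis hy (hn' i)]
  have h := hn' i
  simp only [covMat_apply Y, Fin.sum_univ_three] at h ⊢
  set q := S.tanDeriv i (fun z => Y z 0) y * S.normal y 0 +
    S.tanDeriv i (fun z => Y z 1) y * S.normal y 1 + S.tanDeriv i (fun z => Y z 2) y * S.normal y 2
  linear_combination (-q) * h

theorem IsTangential.of_sum_eq_zero {m : ℕ} (h : ∀ y ∈ S.carrier, ∀ k, IsCmAt m (fun z => X z k)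
    S.carrier y) (h0 : ∀ y ∈ S.carrier, ∑ k, X y k * S.normal y k = 0) : S.IsTangential m X :=
  ⟨fun y hy => IsCmAt.of_coord (h y hy), fun y hy => by rw [inner_eq_sum]; exact h0 y hy⟩

theorem isCmAt_divMat_covMat (hl : 3 ≤ l) (hy : y ∈ S.carrier) (hX : S.IsTangential 2 X)
    (k : Fin 3) : IsCmAt 0 (fun z => S.divMat (S.covMat X) z k) S.carrier y :=
  IsCmAt.sum (η := fun i => S.tanDeriv i fun z => S.covMat X z i k) (s := Finset.univ) fun i _ =>
    S.isCmAt_tanDeriv (by omega) hy (isCmAt_covMat hl hy (hX.1 y hy) i k) i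

/-- Green's formula: `-P div_Γ((∇_Γ X) P)` is the formal adjoint applied to `∇X`. -/
theorem isCovAdjoint_covTensor (hl : 3 ≤ l) (hX : S.IsTangential 2 X) :
    S.IsCovAdjoint (S.covTensor X) fun y => -matVec (S.P y) (S.divMat (S.covMat X) y) := by
  have hZ : S.IsTangential 0 fun y => -matVec (S.P y) (S.divMat (S.covMat X) y) := by
    refine IsTangential.of_sum_eq_zero (fun y hy k => ?_) fun y hy => ?_
    · have hn := S.isCmAt_normal_apply (m := 0) (by omega) hy
      have hA := isCmAt_divMat_covMat hl hy hX
      simp only [PiLp.neg_apply, matVec_P_apply]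
      exact ((hA k).sub ((hn k).mul (IsCmAt.sum fun i _ => (hn i).mul (hA i)))).neg
    · have h1 := S.sum_normal_mul_self hy
      simp only [PiLp.neg_apply, matVec_P_apply, Fin.sum_univ_three] at h1 ⊢
      set V := S.divMat (S.covMat X) y
      linear_combination (S.normal y 0 * V 0 + S.normal y 1 * V 1 + S.normal y 2 * V 2) * h1
  refine ⟨hZ, fun Y hY => ?_⟩
  -- By the product rule, `div_Γ (A Y)` is `div_Γ A · Y` plus the Frobenius product of `A` with `∇_Γ
  -- Y`; `A Y` is tangential because `n` annihilates `A` from the left.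
  set W : R3 → R3 := fun z => WithLp.toLp 2 fun i => ∑ j, S.covMat X z i j * Y z j
  have hA : ∀ y ∈ S.carrier, ∀ i j, IsCmAt 1 (fun z => S.covMat X z i j) S.carrier y :=
    fun y hy => isCmAt_covMat hl hy (hX.1 y hy)
  have hYc : ∀ y ∈ S.carrier, ∀ j, IsCmAt 1 (fun z => Y z j) S.carrier y :=
    fun y hy => (hY.isTangentialAt hy).coord
  have hW : S.IsTangential 1 W := by
    refine IsTangential.of_sum_eq_zero
      (fun y hy k => IsCmAt.sum (η := fun j z => S.covMat X z k j * Y z j) (s := Finset.univ)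
        fun j _ => (hA y hy k j).mul (hYc y hy j)) fun y hy => ?_
    have h := fun j => sum_normal_mul_covMat hy X j
    have h0 := h 0
    have h1 := h 1
    have h2 := h 2
    simp only [W, Fin.sum_univ_three] at h0 h1 h2 ⊢
    linear_combination Y y 0 * h0 + Y y 1 * h1 + Y y 2 * h2
  have hpt : ∀ y ∈ S.carrier, S.formInner y (S.covTensor X y) (S.covTensor Y y) =
      S.div W y + inner ℝ (-matVec (S.P y) (S.divMat (S.covMat X) y)) (Y y) := by
    intro y hy
    have hdiv : S.div W y = ∑ i, ∑ j, (S.tanDeriv i (fun z => S.covMat X z i j) y * Y y j +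
        S.covMat X y i j * S.tanDeriv i (fun z => Y z j) y) := by
      rw [div_apply]
      refine Finset.sum_congr rfl fun i _ => ?_
      simp only [W]
      rw [S.tanDeriv_sum (by omega) hy fun j _ => (hA y hy i j).mul (hYc y hy j)]
      exact Finset.sum_congr rfl fun j _ => S.tanDeriv_mul (by omega) hy (hA y hy i j) (hYc y hy j)
    have hYn := (hY.isTangentialAt hy).sum_eq_zero hy
    have hV : ∀ j, S.divMat (S.covMat X) y j =
      ∑ i, S.tanDeriv i (fun z => S.covMat X z i j) y := fun _ => rfl
    have hdiv' : S.div W y = ∑ j, S.divMat (S.covMat X) y j * Y y j +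
        ∑ i, ∑ j, S.covMat X y i j * S.tanDeriv i (fun z => Y z j) y := by
      simp only [hdiv, hV, Finset.sum_add_distrib, Finset.sum_mul]
      rw [Finset.sum_comm]
    rw [formInner_covTensor hy, hdiv', inner_eq_sum]
    simp only [PiLp.neg_apply, matVec_P_apply, Fin.sum_univ_three] at hYn ⊢
    set V := S.divMat (S.covMat X) y
    linear_combination (-(S.normal y 0 * V 0 + S.normal y 1 * V 1 + S.normal y 2 * V 2)) * hYn
  rw [setIntegral_congr_fun S.isCompact.measurableSet hpt, integral_add,
    S.integral_div_eq_zero (by omega) hW, zero_add]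
  · exact S.integrableOn_of_continuousOn (by omega) (S.continuousOn_div (by omega) hW)
  · exact S.integrableOn_of_continuousOn (by omega) (hZ.1.continuousOn.inner hY.1.continuousOn)

/-- The formal adjoint is determined on the surface. -/
theorem IsCovAdjoint.eq {T : R3 → R3 → R3 → ℝ} {Z Z' : R3 → R3} (hl : 2 ≤ l)
    (h : S.IsCovAdjoint T Z) (h' : S.IsCovAdjoint T Z') (hy : y ∈ S.carrier) : Z y = Z' y := by
  by_contra hne
  obtain ⟨w, hw⟩ : ∃ w, w = Z y - Z' y := ⟨_, rfl⟩
  have hw0 : 0 < inner ℝ (Z y - Z' y) w := by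
    rw [hw, real_inner_self_eq_norm_sq]
    exact pow_pos (norm_pos_iff.mpr (sub_ne_zero.mpr hne)) 2
  have hZc := h.1.1.continuousOn
  have hZc' := h'.1.1.continuousOn
  have hc : ContinuousOn (fun z => inner ℝ (Z z - Z' z) w) S.carrier :=
    (hZc.sub hZc').inner continuousOn_const
  obtain ⟨V, hV, hyV, hVw⟩ := mem_nhdsWithin.mp ((hc y hy).eventually (lt_mem_nhds hw0))
  obtain ⟨ε, hε, hball⟩ := Metric.isOpen_iff.mp hV y hyV
  let χ : ContDiffBump y := ⟨ε / 2, ε, half_pos hε, half_lt_self hε⟩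
  -- The test field is the constant vector `w = Z y - Z' y`, projected to the tangent planes and cut
  -- off where `(Z - Z') · w` is positive. The projection does not alter the pairing with the
  -- tangential field `Z - Z'`.
  let Y : R3 → R3 := fun z => χ z • (w - (∑ k, w k * S.normal z k) • S.normal z)
  have hY : S.IsTangential 1 Y := by
    refine S.isTangential_smul χ.contDiff
      (IsTangential.of_sum_eq_zero (fun z hz k => ?_) fun z hz => ?_)
    · have hn := S.isCmAt_normal_apply (m := 1) hl hz
      exact (IsCmAt.const (w k)).sub
        ((IsCmAt.sum fun k _ => (IsCmAt.const (w k)).mul (hn k)).mul (hn k))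
    · have h1 := S.sum_normal_mul_self hz
      simp only [PiLp.sub_apply, PiLp.smul_apply, smul_eq_mul, Fin.sum_univ_three] at h1 ⊢
      linear_combination (-(w 0 * S.normal z 0 + w 1 * S.normal z 1 + w 2 * S.normal z 2)) * h1
  have hpt : ∀ z ∈ S.carrier, inner ℝ (Z z) (Y z) - inner ℝ (Z' z) (Y z) =
      χ z * inner ℝ (Z z - Z' z) w := by
    intro z hz
    simp only [Y]
    rw [inner_smul_right, inner_smul_right, inner_sub_right, inner_sub_right, inner_smul_right,
      inner_smul_right, h.1.2 z hz, h'.1.2 z hz, inner_sub_left]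
    ring
  have hYc := hY.1.continuousOn
  have hint : ∫ z in S.carrier, χ z * inner ℝ (Z z - Z' z) w ∂μHE[2] = 0 := by
    rw [← setIntegral_congr_fun S.isCompact.measurableSet hpt, integral_sub, h.2 Y hY, h'.2 Y hY,
      sub_self]
    · exact S.integrableOn_of_continuousOn (by omega) (hZc.inner hYc)
    · exact S.integrableOn_of_continuousOn (by omega) (hZc'.inner hYc)
  have hχc : ContinuousOn (fun z => χ z * inner ℝ (Z z - Z' z) w) S.carrier :=
    χ.continuous.continuousOn.mul hc
  have h0 := S.eq_zero_of_integral_eq_zero (by omega) hχc (fun z hz => ?_) hint hy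
  · rw [χ.one_of_mem_closedBall (Metric.mem_closedBall_self (half_pos hε).le), one_mul] at h0
    exact hw0.ne' h0
  · by_cases hzε : z ∈ Metric.ball y ε
    · exact mul_nonneg χ.nonneg (hVw ⟨hball hzε, hz⟩ : 0 < inner ℝ (Z z - Z' z) w).le
    · rw [χ.zero_of_le_dist (by simpa using hzε), zero_mul]

theorem isCovAdjoint_covAdjoint (hl : 3 ≤ l) (hX : S.IsTangential 2 X) :
    S.IsCovAdjoint (S.covTensor X) (S.covAdjoint (S.covTensor X)) := by
  have h : ∃ Z, S.IsCovAdjoint (S.covTensor X) Z := ⟨_, isCovAdjoint_covTensor hl hX⟩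
  rw [covAdjoint, dif_pos h]
  exact h.choose_spec

/-- By uniqueness, the adjoint chosen in `covAdjoint` agrees on `Γ` with the explicit one from
Green's formula. -/
theorem bochner_eq (hl : 3 ≤ l) (hX : S.IsTangential 2 X) (hy : y ∈ S.carrier) :
    S.bochner X y = matVec (S.P y) (S.divMat (S.covMat X) y) := by
  rw [bochner, (isCovAdjoint_covAdjoint hl hX).eq (by omega) (isCovAdjoint_covTensor hl hX) hy,
    neg_neg]

/-- The viscous term in terms of the Bochner Laplacian and the Ricci curvature. -/
theorem two_smul_matVec_divMat_strain_eq_bochner (hl : 3 ≤ l) (hX : S.IsTangential 2 X)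
    (hy : y ∈ S.carrier) : (2 : ℝ) • matVec (S.P y) (S.divMat (S.strain X) y) =
      S.bochner X y + S.grad (S.div X) y + S.ricci X y := by
  ext j
  rw [two_smul_matVec_divMat_strain hl hy (hX.isTangentialAt hy), PiLp.add_apply, PiLp.add_apply,
    bochner_eq hl hX hy, ricci_apply hl hy (hX.isTangentialAt hy)]

/-! ### The limit equations with constant weight. -/

theorem grad_eq_zero_of_eq_const (hl : 1 ≤ l) {g : R3 → ℝ} {c : ℝ} (hg : ∀ y ∈ S.carrier, g y = c)
    (hy : y ∈ S.carrier) : S.grad g y = 0 := by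
  ext i
  change S.tanDeriv i g y = 0
  rw [S.tanDeriv_congr hy (ζ := fun _ => c), S.tanDeriv_const hl hy]
  filter_upwards [self_mem_nhdsWithin] with z hz using hg z hz

theorem divMat_congr {A B : R3 → Matrix (Fin 3) (Fin 3) ℝ} (hy : y ∈ S.carrier)
    (h : ∀ z ∈ S.carrier, A z = B z) : S.divMat A y = S.divMat B y := by
  ext j
  simp only [divMat]
  refine Finset.sum_congr rfl fun i _ => S.tanDeriv_congr hy ?_
  filter_upwards [self_mem_nhdsWithin] with z hz
  rw [h z hz]

/-- The weight `g` is `1` only on `Γ`; this is enough because the surface operators depend on values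
on `Γ` alone. -/
theorem solvesLimitEquations_iff_solvesRiemannianNavierStokes (hl : 3 ≤ l) {ν : ℝ} {g : R3 → ℝ}
    {f : ℝ → R3 → R3} {v₀ : R3 → R3} {v : ℝ → R3 → R3} {q : ℝ → R3 → ℝ}
    (hg : ∀ y ∈ S.carrier, g y = 1) (hv : ∀ t > 0, S.IsTangential 2 (v t)) :
    S.SolvesLimitEquations ν 0 0 g f v₀ v q ↔ S.SolvesRiemannianNavierStokes ν f v₀ v q := by
  have hdiv : ∀ t, ∀ y ∈ S.carrier, S.div (fun z => g z • v t z) y = S.div (v t) y := by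
    intro t y hy
    refine S.div_congr hy ?_
    filter_upwards [self_mem_nhdsWithin] with z hz
    rw [hg z hz, one_smul]
  have hstrain : ∀ t, ∀ y ∈ S.carrier,
      S.divMat (fun z => g z • S.strain (v t) z) y = S.divMat (S.strain (v t)) y := fun t y hy =>
    divMat_congr hy fun z hz => by rw [hg z hz, one_smul]
  have hgrad : ∀ y ∈ S.carrier, S.grad g y = 0 := fun y hy =>
    grad_eq_zero_of_eq_const (by omega) hg hy
  unfold SolvesLimitEquations SolvesRiemannianNavierStokes
  have hd : (∀ t > 0, ∀ y ∈ S.carrier, S.div (fun z => g z • v t z) y = 0) ↔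
      ∀ t > 0, ∀ y ∈ S.carrier, S.div (v t) y = 0 :=
    forall₄_congr fun t _ y hy => by rw [hdiv t y hy]
  -- The divergence and initial conditions of the two systems now coincide, so they may be assumed
  -- while the momentum equations are compared. The divergence condition makes `∇_Γ div_Γ v` vanish.
  rw [hd, and_congr_left_iff]
  rintro ⟨hv0, -⟩
  refine forall₄_congr fun t ht y hy => ?_
  have h := two_smul_matVec_divMat_strain_eq_bochner hl (hv t ht) hy
  rw [grad_eq_zero_of_eq_const (by omega) (hv0 t ht) hy, add_zero] at h
  rw [hg y hy, hgrad y hy, hstrain t y hy, ← h, mul_comm 2 ν, mul_smul]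
  simp

end ClosedSurface

end

theorem lemmaC10 (S : ClosedSurface 3) :
    (∀ X : R3 → R3, S.IsTangential 2 X →
      -- the Bochner Laplacian of `X` is well defined
      S.IsCovAdjoint (S.covTensor X) (S.covAdjoint (S.covTensor X)) ∧
      (∀ Z, S.IsCovAdjoint (S.covTensor X) Z → ∀ y ∈ S.carrier, S.bochner X y = -Z y) ∧
      -- the Ricci curvature of `X` is well defined
      (∀ y ∈ S.carrier, ∃ V τ, S.IsFrame V τ ∧ y ∈ V) ∧
      (∀ V τ, S.IsFrame V τ → ∀ y ∈ S.carrier ∩ V,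
        S.ricci X y = ∑ i, S.curv X (τ i) (τ i) y) ∧
      -- the formula
      (∀ y ∈ S.carrier,
        (2 : ℝ) • matVec (S.P y) (S.divMat (S.strain X) y) =
          S.bochner X y + S.grad (S.div X) y + S.ricci X y)) ∧
    -- the limit equations with weight one and without friction
    (∀ (ν : ℝ) (g : R3 → ℝ) (f : ℝ → R3 → R3) (v₀ : R3 → R3)
      (v : ℝ → R3 → R3) (q : ℝ → R3 → ℝ),
      0 < ν → (∀ y ∈ S.carrier, g y = 1) →
      (∀ t > 0, S.IsTangential 2 (v t)) →
      (∀ t > 0, ∀ y ∈ S.carrier, DifferentiableAt ℝ (fun s => v s y) t) →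
      (∀ t > 0, IsCmOn 1 (q t) S.carrier) →
      (S.SolvesLimitEquations ν 0 0 g f v₀ v q ↔
        S.SolvesRiemannianNavierStokes ν f v₀ v q)) := by
  refine ⟨fun X hX => ⟨ClosedSurface.isCovAdjoint_covAdjoint le_rfl hX, fun Z hZ y hy => ?_,
    fun y hy => ClosedSurface.exists_isFrame le_rfl hy, fun V τ hτ y hy => ?_,
    fun y hy => ClosedSurface.two_smul_matVec_divMat_strain_eq_bochner le_rfl hX hy⟩,
    fun ν g f v₀ v q _ hg hv _ _ =>
      ClosedSurface.solvesLimitEquations_iff_solvesRiemannianNavierStokes le_rfl hg hv⟩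
  · rw [ClosedSurface.bochner, (ClosedSurface.isCovAdjoint_covAdjoint le_rfl hX).eq (by norm_num)
      hZ hy]
  · ext j
    rw [ClosedSurface.ricci_apply le_rfl hy.1 (hX.isTangentialAt hy.1),
      ClosedSurface.sum_curv_apply le_rfl (hX.isTangentialAt hy.1) hτ hy]
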